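/- Let $n$ be a natural number, let $0<\zeta_1<\dots<\zeta_{\lfloor n/2\rfloor}$ and $b_1,\dots,b_{\lfloor n/2\rfloor}>0$, let $c>0$ if $n$ is odd and $c=0$ if $n$ is even, and put $$\mu=\sum_{j=1}^{\lfloor n/2\rfloor}b_j\delta_{\zeta_j},\qquad W(z)=c+\int\frac{d\mu(x)}{x-z},\qquad \hat\mu_c(y)=c+\int\frac{d\mu(x)}{y+x}.$$ **Inverse problem.** Given positive $m_1,\dots,m_n$, find positive $g_j,h_j$ ($1\le j\le n$) with $g_jh_j=m_j^2$ such that the solution of $q_0=0$, $p_0=1$, $q_k-q_{k-1}=h_kp_{k-1}$, $p_k-p_{k-1}=-zg_kq_{k-1}$ ($1\le k\le n$) satisfies $W(z)=q_n(z)/p_n(z)$ as rational functions of $z$. The associated positions $x_j\in\mathbf R$ are defined by $h_j=m_je^{x_j}$ (equivalently $g_j=m_je^{-x_j}$). **Notation.** Let $k'=n+1-k$, $e_k=1/m_{k'}^2$, $\mathbf e_{[1,k]}=e_1\cdots e_k$. For $0\le l\le k\le n$ and $p\ge0$ with $p+l-1\le k-l$, let $CSV_k^{(l,p)}$ be the $k\times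 k$ (Cauchy–Stieltjes–Vandermonde) matrix with $i$-th row $$e_i^p\hat\mu_c(e_i),\;e_i^{p+1}\hat\mu_c(e_i),\;\dots,\;e_i^{p+l-1}\hat\mu_c(e_i),\;1,\;e_i,\;\dots,\;e_i^{k-l-1},$$ and let $\mathcal D_k^{(l,p)}=|\det CSV_k^{(l,p)}|$, with $\mathcal D_0^{(l,p)}=1$. **(1)** If $m_1,\dots,m_n$ are positive and pairwise distinct, the inverse problem has exactly one solution, and for $1\le k\le n$ $$g_{k'}=\frac{\mathcal D_k^{(\frac{k-1}2,1)}\mathcal D_{k-1}^{(\frac{k-1}2,1)}}{\mathbf e_{[1,k]}\mathcal D_k^{(\frac{k+1}2,0)}\mathcal D_{k-1}^{(\frac{k-1}2,0)}},\qquad h_{k'}=\frac{\mathbf e_{[1,k-1]}\mathcal D_k^{(\frac{k+1}2,0)}\mathcal D_{k-1}^{(\frac{k-1}2,0)}}{\mathcal D_k^{(\frac{k-1}2,1)}\mathcal D_{k-1}^{(\frac{k-1}2,1)}}\qquad(k\text{ odd}),$$ $$g_{k'}=\frac{\mathcal D_k^{(\frac k2,1)}\mathcal D_{k-1}^{(\frac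 k2-1,1)}}{\mathbf e_{[1,k]}\mathcal D_k^{(\frac k2,0)}\mathcal D_{k-1}^{(\frac k2,0)}},\qquad h_{k'}=\frac{\mathbf e_{[1,k-1]}\mathcal D_k^{(\frac k2,0)}\mathcal D_{k-1}^{(\frac k2,0)}}{\mathcal D_k^{(\frac k2,1)}\mathcal D_{k-1}^{(\frac k2-1,1)}}\qquad(k\text{ even}).$$ The associated positions are $$x_{k'}=\ln\frac{h_{k'}}{m_{k'}}=\begin{cases}\displaystyle\ln\frac{\mathbf e_{[1,k-1]}\mathcal D_k^{(\frac{k+1}2,0)}\mathcal D_{k-1}^{(\frac{k-1}2,0)}}{m_{k'}\mathcal D_k^{(\frac{k-1}2,1)}\mathcal D_{k-1}^{(\frac{k-1}2,1)}},&k\text{ odd},\\[3ex]\displaystyle\ln\frac{\mathbf e_{[1,k-1]}\mathcal D_k^{(\frac k2,0)}\mathcal D_{k-1}^{(\frac k2,0)}}{m_{k'}\mathcal D_k^{(\frac k2,1)}\mathcal D_{k-1}^{(\frac k2-1,1)}},&k\text{ even}.\end{cases}$$ Moreover, for any $y_1<\dots<y_n$ put $g=\sum_j m_je^{-y_j}\delta_{y_j}$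 and $h=\sum_j m_je^{y_j}\delta_{y_j}$, and let $(\Phi_1,\Phi_2)$ be the left-continuous solution of $\partial_x\Phi_1=h\Phi_2$, $\partial_x\Phi_2=-zg\Phi_1$, $\Phi_1(-\infty)=0$, $\Phi_2(-\infty)=1$, where $\Phi_a\delta_{y_j}=\Phi_a(y_j)\delta_{y_j}$. Then $\Phi_1(+\infty)/\Phi_2(+\infty)=W(z)$ as rational functions of $z$ if and only if $y_j=x_j$ for all $j$. **(2)** For fixed $\zeta,b,c$, the above formulas for $g_j$, $h_j$, $x_j$, as functions of $(m_1,\dots,m_n)$, extend continuously from the distinct positive masses to all positive masses, possibly coinciding. For all positive masses the inverse problem has exactly one solution; it and its positions $x_j=\ln(h_j/m_j)$ are given by the extended formulas, and the last assertion of (1) holds with these $x_j$. -/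

import Mathlib

open MeasureTheory Filter Topology

noncomputable section

namespace MCH

/-- The discrete measure `∑ j, w j • δ_(x j)` on the real line, for nonnegative weights `w`. -/
def discreteMeasure {N : ℕ} (x w : Fin N → ℝ) : Measure ℝ :=
  ∑ j, ENNReal.ofReal (w j) • Measure.dirac (x j)

/-! ### The boundary value problem and its Weyl function -/

/-- The vector `(q_k(z), p_k(z))`, `0 ≤ k ≤ n`, determined by `q_0 = 0`, `p_0 = 1` and
`q_k - q_{k-1} = h_k p_{k-1}`, `p_k - p_{k-1} = - z g_k q_{k-1}`
(the `k`-th site is stored at the index `k - 1 : Fin n`). -/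
def ivp {n : ℕ} (g h : Fin n → ℝ) (z : ℂ) : Fin (n + 1) → ℂ × ℂ :=
  Fin.induction (motive := fun _ => ℂ × ℂ) (0, 1)
    (fun k s => (s.1 + h k * s.2, s.2 - z * g k * s.1))

/-- `ivp` is the unique solution of the initial value problem. -/
theorem ivp_unique {n : ℕ} (g h : Fin n → ℝ) (z : ℂ) (q p : Fin (n + 1) → ℂ) :
    (q 0 = 0 ∧ p 0 = 1 ∧ ∀ k : Fin n,
      q k.succ - q k.castSucc = h k * p k.castSucc ∧
      p k.succ - p k.castSucc = - z * g k * q k.castSucc) ↔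
    ∀ k, (q k, p k) = ivp g h z k := by
  constructor
  · rintro ⟨h0, h1, hs⟩ k
    induction k using Fin.induction with
    | zero => simp [ivp, h0, h1]
    | succ k ih =>
      have e : ivp g h z k.succ = ((ivp g h z k.castSucc).1 + h k * (ivp g h z k.castSucc).2,
          (ivp g h z k.castSucc).2 - z * g k * (ivp g h z k.castSucc).1) := by
        simp [ivp]
      rw [e, ← ih]
      obtain ⟨ha, hb⟩ := hs k
      refine Prod.ext ?_ ?_
      · simp only
        linear_combination ha
      · simp only
        linear_combination hb
  · intro H
    have hz := H 0
    simp only [ivp, Fin.induction_zero, Prod.mk.injEq] at hz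
    refine ⟨hz.1, hz.2, fun k => ?_⟩
    have e : ivp g h z k.succ = ((ivp g h z k.castSucc).1 + h k * (ivp g h z k.castSucc).2,
        (ivp g h z k.castSucc).2 - z * g k * (ivp g h z k.castSucc).1) := by
      simp [ivp]
    have hsucc := H k.succ
    rw [e, ← H k.castSucc] at hsucc
    simp only [Prod.mk.injEq] at hsucc
    exact ⟨by rw [hsucc.1]; ring, by rw [hsucc.2]; ring⟩

/-- The shifted Stieltjes transform `W(z) = c + ∫ dμ(x) / (x - z)`. -/
def weyl (μ : Measure ℝ) (c : ℝ) (z : ℂ) : ℂ := c + ∫ x, 1 / ((x : ℂ) - z) ∂μ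

/-- `(g, h)` solves the inverse problem with masses `m` and spectral data `(μ, c)`:
`g` and `h` are positive, `g_j h_j = m_j²`, and `W = q_n / p_n` as rational functions, that is,
at all but finitely many points `z`. -/
structure IsInverseSolution {n : ℕ} (m : Fin n → ℝ) (μ : Measure ℝ) (c : ℝ)
    (g h : Fin n → ℝ) : Prop where
  g_pos : ∀ j, 0 < g j
  h_pos : ∀ j, 0 < h j
  g_mul_h : ∀ j, g j * h j = m j ^ 2
  weyl_eq : ∀ᶠ z : ℂ in cofinite,
    weyl μ c z = (ivp g h z (Fin.last n)).1 / (ivp g h z (Fin.last n)).2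

/-- `(Φ₁, Φ₂)` is the left-continuous solution of `Φ₁' = Φ₂ h`, `Φ₂' = - z Φ₁ g`
with `Φ₁(-∞) = 0`, `Φ₂(-∞) = 1`, for measures `g`, `h`, where `Φ_a δ_x = Φ_a(x) δ_x`. -/
def IsLeftSolution (g h : Measure ℝ) (z : ℂ) (Φ₁ Φ₂ : ℝ → ℂ) : Prop :=
  ∀ y : ℝ, Φ₁ y = ∫ ξ in Set.Iio y, Φ₂ ξ ∂h ∧ Φ₂ y = 1 - z * ∫ ξ in Set.Iio y, Φ₁ ξ ∂g

/-- The positions `x_1 < ⋯ < x_n` with masses `m` have spectral data `(μ, c)`: with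
`g = ∑ m_j e^{-x_j} δ_{x_j}` and `h = ∑ m_j e^{x_j} δ_{x_j}`, the Weyl function
`Φ₁(+∞) / Φ₂(+∞)` is the rational function `W(z) = c + ∫ dμ(x) / (x - z)`. -/
def HasSpectralData {n : ℕ} (m x : Fin n → ℝ) (μ : Measure ℝ) (c : ℝ) : Prop :=
  ∃ Φ₁ Φ₂ : ℂ → ℝ → ℂ,
    (∀ z, IsLeftSolution (discreteMeasure x fun j => m j * Real.exp (-x j))
      (discreteMeasure x fun j => m j * Real.exp (x j)) z (Φ₁ z) (Φ₂ z)) ∧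
    ∀ᶠ z : ℂ in cofinite, Tendsto (fun y => Φ₁ z y / Φ₂ z y) atTop (𝓝 (weyl μ c z))

/-- The inverse problem with masses `m` and spectral data `(μ, c)` has exactly one solution,
namely `(g, h)`; the numbers `x_j` are the associated positions, `x_j = ln (h_j / m_j)`; and if
an increasing configuration of positions has spectral data `(μ, c)`, then it is `x` (and `x`
has these spectral data if it is increasing). -/
def IsTheSolution {n : ℕ} (m : Fin n → ℝ) (μ : Measure ℝ) (c : ℝ) (g h x : Fin n → ℝ) : Prop :=
  (∀ g' h' : Fin n → ℝ, IsInverseSolution m μ c g' h' ↔ g' = g ∧ h' = h) ∧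
  (∀ j, x j = Real.log (h j / m j)) ∧
  ∀ y : Fin n → ℝ, StrictMono y → (HasSpectralData m y μ c ↔ y = x)

/-! ### Cauchy-Stieltjes-Vandermonde matrices and the explicit formulas -/

/-- The transform `ν̂_c(y) = c + ∫ dν(x) / (y + x)`. -/
def stieltjes (ν : Measure ℝ) (c : ℝ) (y : ℝ) : ℝ := c + ∫ x, 1 / (y + x) ∂ν

/-- The Cauchy-Stieltjes-Vandermonde matrix `CSV_k^{(l,p)}(e, ν, c)`, whose `i`-th row is
`e_i^p ν̂_c(e_i), …, e_i^{p+l-1} ν̂_c(e_i), 1, e_i, …, e_i^{k-l-1}`. -/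
def csv (k l p : ℕ) (e : Fin k → ℝ) (ν : Measure ℝ) (c : ℝ) : Matrix (Fin k) (Fin k) ℝ :=
  Matrix.of fun i j =>
    if (j : ℕ) < l then e i ^ (p + (j : ℕ)) * stieltjes ν c (e i) else e i ^ ((j : ℕ) - l)

/-- The first `k` of the numbers `e_i = 1 / m_{i'}²`, where `i' = n + 1 - i`. -/
def nodes {n : ℕ} (m : Fin n → ℝ) (k : Fin (n + 1)) (i : Fin k) : ℝ :=
  1 / m (Fin.castLE k.is_le i).rev ^ 2

/-- The product `e_{[1,k]} = e_1 ⋯ e_k`. -/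
def nodeProd {n : ℕ} (m : Fin n → ℝ) (k : Fin (n + 1)) : ℝ := ∏ i, nodes m k i

/-- `𝒟_k^{(l,p)} = |det CSV_k^{(l,p)}(e, μ, c)|`; in particular `𝒟_0^{(l,p)} = 1`. -/
def absDet {n : ℕ} (m : Fin n → ℝ) (μ : Measure ℝ) (c : ℝ) (k : Fin (n + 1)) (l p : ℕ) : ℝ :=
  |(csv k l p (nodes m k) μ c).det|

/-- The formula for `g_{k'}`, `k' = n + 1 - k`, where `k = i + 1` (so that `i.succ` stands for
`k` and `i.castSucc` for `k - 1`, and the site `k'` is stored at the index `i.rev`). -/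
def gFormula {n : ℕ} (m : Fin n → ℝ) (μ : Measure ℝ) (c : ℝ) (i : Fin n) : ℝ :=
  let k : ℕ := (i : ℕ) + 1
  let D : ℕ → ℕ → ℝ := absDet m μ c i.succ
  let D' : ℕ → ℕ → ℝ := absDet m μ c i.castSucc
  if Odd k then
    D ((k - 1) / 2) 1 * D' ((k - 1) / 2) 1 /
      (nodeProd m i.succ * D ((k + 1) / 2) 0 * D' ((k - 1) / 2) 0)
  else
    D (k / 2) 1 * D' (k / 2 - 1) 1 / (nodeProd m i.succ * D (k / 2) 0 * D' (k / 2) 0)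

/-- The formula for `h_{k'}`, with `k = i + 1`. -/
def hFormula {n : ℕ} (m : Fin n → ℝ) (μ : Measure ℝ) (c : ℝ) (i : Fin n) : ℝ :=
  let k : ℕ := (i : ℕ) + 1
  let D : ℕ → ℕ → ℝ := absDet m μ c i.succ
  let D' : ℕ → ℕ → ℝ := absDet m μ c i.castSucc
  if Odd k then
    nodeProd m i.castSucc * D ((k + 1) / 2) 0 * D' ((k - 1) / 2) 0 /
      (D ((k - 1) / 2) 1 * D' ((k - 1) / 2) 1)
  else
    nodeProd m i.castSucc * D (k / 2) 0 * D' (k / 2) 0 / (D (k / 2) 1 * D' (k / 2 - 1) 1)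

/-- The formula for `x_{k'}`, with `k = i + 1`. -/
def xFormula {n : ℕ} (m : Fin n → ℝ) (μ : Measure ℝ) (c : ℝ) (i : Fin n) : ℝ :=
  let k : ℕ := (i : ℕ) + 1
  let D : ℕ → ℕ → ℝ := absDet m μ c i.succ
  let D' : ℕ → ℕ → ℝ := absDet m μ c i.castSucc
  if Odd k then
    Real.log (nodeProd m i.castSucc * D ((k + 1) / 2) 0 * D' ((k - 1) / 2) 0 /
      (m i.rev * D ((k - 1) / 2) 1 * D' ((k - 1) / 2) 1))
  else
    Real.log (nodeProd m i.castSucc * D (k / 2) 0 * D' (k / 2) 0 /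
      (m i.rev * D (k / 2) 1 * D' (k / 2 - 1) 1))

end MCH

end

noncomputable section

namespace MCH

open Polynomial

/-! ### Discrete measures -/

/-! Put `x = -z`. One site acts on `(q, p)` by the matrix with rows `(1, h)` and `(x g, 1)`, whose
determinant `1 - x g h = 1 - x m²` vanishes exactly at the node `x = 1 / m²`. There the image is
one-dimensional, so the last weight is forced: `h_n = q_n / p_n = W(-e_1)`. Inverting the step and
dividing out the factor `e_1 - x` leaves the problem with one site fewer.

Uniqueness: all weights are obtained from `W` by iterating this. `peel` performs the division on
partial fraction coefficients, so no difference of nodes appears in a denominator and coinciding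
masses are harmless (`chain_eq_peel`).

Existence: the reduced quotient is again a shifted Stieltjes transform with positive data, because
the zeros of its denominator interlace the old poles (`exists_quotient_of_pos`,
`exists_quotient_of_zero`). Each step alternates between a positive and a zero constant term,
matching the parity of the number of sites (`Admissible.exists_step`), and induction rebuilds the
sites.

Determinants: undoing `k` steps writes `q_{n-k}` and `p_{n-k}`, times the product of the `k` step
determinants, as polynomial combinations of `q_n` and `p_n`. Divided by `p_n`, these vanish at `e_1,
…, e_k`, so they are column combinations of a `CSV` matrix of size `k + 1` vanishing in all rows but
the last. Expanding gives a recursion for the determinants (`abs_det_csv_succ`), and the quotient of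
its two cases yields `h` (`weight_eq_det`). Distinct masses make the determinants nonzero.

The continuous extension in part (2) is the recursive solution itself: its denominators never
vanish, since a solution exists for all positive masses. -/

theorem setIntegral_discreteMeasure {N : ℕ} (x w : Fin N → ℝ) (hw : ∀ j, 0 ≤ w j) (f : ℝ → ℂ)
    {s : Set ℝ} (hs : MeasurableSet s) [DecidablePred (· ∈ s)] :
    ∫ t in s, f t ∂(discreteMeasure x w) = ∑ j, if x j ∈ s then (w j : ℂ) * f (x j) else 0 := by
  have h1 : (discreteMeasure x w).restrict s =
      ∑ j, if x j ∈ s then ENNReal.ofReal (w j) • Measure.dirac (x j) else 0 := by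
    ext t ht
    simp only [discreteMeasure, Measure.restrict_apply ht, Measure.finsetSum_apply]
    refine Finset.sum_congr rfl fun j _ => ?_
    by_cases h : x j ∈ s
    · by_cases h' : x j ∈ t <;>
        simp [h, h', Measure.dirac_apply' _ ht, Measure.dirac_apply' _ (ht.inter hs)]
    · simp [h, Measure.dirac_apply' _ (ht.inter hs), Set.indicator]
  rw [h1, integral_finsetSum_measure]
  · refine Finset.sum_congr rfl fun j _ => ?_
    split_ifs with h
    · rw [integral_smul_measure, integral_dirac, ENNReal.toReal_ofReal (hw j)]
      simp
    · simp
  · intro j _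
    split_ifs with h
    · exact (integrable_dirac (by simp)).smul_measure ENNReal.ofReal_ne_top
    · simp

theorem integral_discreteMeasure {N : ℕ} {E : Type*} [NormedAddCommGroup E] [NormedSpace ℝ E]
    [CompleteSpace E] (x w : Fin N → ℝ) (hw : ∀ j, 0 ≤ w j) (f : ℝ → E) :
    ∫ t, f t ∂(discreteMeasure x w) = ∑ j, w j • f (x j) := by
  rw [discreteMeasure, integral_finsetSum_measure]
  · refine Finset.sum_congr rfl fun j _ => ?_
    rw [integral_smul_measure, integral_dirac, ENNReal.toReal_ofReal (hw j)]
  · intro j _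
    exact (integrable_dirac (by simp)).smul_measure ENNReal.ofReal_ne_top

theorem weyl_discreteMeasure {N : ℕ} (ζ b : Fin N → ℝ) (hb : ∀ j, 0 < b j) (c : ℝ) (z : ℂ) :
    weyl (discreteMeasure ζ b) c z = c + ∑ j, (b j : ℂ) / (ζ j - z) := by
  rw [weyl, integral_discreteMeasure _ _ fun j => (hb j).le]
  simp [div_eq_mul_inv]

theorem stieltjes_discreteMeasure {N : ℕ} (ζ b : Fin N → ℝ) (hb : ∀ j, 0 < b j) (c x : ℝ) :
    stieltjes (discreteMeasure ζ b) c x = c + ∑ j, b j / (x + ζ j) := by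
  rw [stieltjes, integral_discreteMeasure _ _ fun j => (hb j).le]
  simp [div_eq_mul_inv]

/-! ### The boundary value problem in terms of polynomials -/

/-- The solution `(q_k, p_k)` of the initial value problem, as polynomials in `x = - z`. -/
def chain (g h : ℕ → ℝ) : ℕ → ℝ[X] × ℝ[X]
  | 0 => (0, 1)
  | k + 1 => ((chain g h k).1 + C (h k) * (chain g h k).2,
      (chain g h k).2 + X * C (g k) * (chain g h k).1)

theorem ivp_eq_chain {n : ℕ} (g h : Fin n → ℝ) (G H : ℕ → ℝ) (hG : ∀ j : Fin n, G j = g j)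
    (hH : ∀ j : Fin n, H j = h j) (z : ℂ) (k : Fin (n + 1)) :
    ivp g h z k = (aeval (-z) (chain G H k).1, aeval (-z) (chain G H k).2) := by
  induction k using Fin.induction with
  | zero => simp [ivp, chain]
  | succ k ih =>
    have e : ivp g h z k.succ = ((ivp g h z k.castSucc).1 + h k * (ivp g h z k.castSucc).2,
        (ivp g h z k.castSucc).2 - z * g k * (ivp g h z k.castSucc).1) := by
      simp [ivp]
    rw [e, ih]
    simp [chain, hG, hH, sub_eq_add_neg, mul_comm z]

theorem chain_nonneg_pos {g h : ℕ → ℝ} (hg : ∀ k, 0 < g k) (hh : ∀ k, 0 < h k) {x : ℝ}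
    (hx : 0 < x) (k : ℕ) :
    0 ≤ (chain g h k).1.eval x ∧ 0 < (chain g h k).2.eval x := by
  induction k with
  | zero => simp [chain]
  | succ k ih =>
    obtain ⟨h1, h2⟩ := ih
    have := hg k
    have := hh k
    simp only [chain, eval_add, eval_mul, eval_C, eval_X]
    constructor <;> positivity

theorem chain_fst_succ_pos {g h : ℕ → ℝ} (hg : ∀ k, 0 < g k) (hh : ∀ k, 0 < h k) {x : ℝ}
    (hx : 0 < x) (k : ℕ) : 0 < (chain g h (k + 1)).1.eval x := by
  obtain ⟨h1, h2⟩ := chain_nonneg_pos hg hh hx k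
  have := hh k
  simp only [chain, eval_add, eval_mul, eval_C]
  positivity

/-- Inverting one step of the initial value problem. -/
theorem chain_fst_back (g h : ℕ → ℝ) (x : ℝ) (k : ℕ) :
    (chain g h (k + 1)).1.eval x - h k * (chain g h (k + 1)).2.eval x =
      (chain g h k).1.eval x * (1 - x * (g k * h k)) := by
  simp only [chain, eval_add, eval_mul, eval_C, eval_X]; ring

theorem chain_snd_back (g h : ℕ → ℝ) (x : ℝ) (k : ℕ) :
    (chain g h (k + 1)).2.eval x - x * g k * (chain g h (k + 1)).1.eval x =
      (chain g h k).2.eval x * (1 - x * (g k * h k)) := by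
  simp only [chain, eval_add, eval_mul, eval_C, eval_X]; ring

/-- Continuous functions on `(0, ∞)` that agree at all but finitely many points agree. -/
theorem eqOn_Ioi_of_cofinite {f₁ f₂ : ℝ → ℝ} (h₁ : ContinuousOn f₁ (Set.Ioi 0))
    (h₂ : ContinuousOn f₂ (Set.Ioi 0)) (h : ∀ᶠ x in cofinite, 0 < x → f₁ x = f₂ x) {x : ℝ}
    (hx : 0 < x) : f₁ x = f₂ x := by
  have c₁ := (h₁.continuousAt (Ioi_mem_nhds hx)).tendsto.mono_left
    (nhdsWithin_le_nhds (s := {x}ᶜ))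
  have c₂ := (h₂.continuousAt (Ioi_mem_nhds hx)).tendsto.mono_left
    (nhdsWithin_le_nhds (s := {x}ᶜ))
  refine tendsto_nhds_unique_of_eventuallyEq c₁ c₂ ?_
  filter_upwards [nhdsNE_le_cofinite x h, nhdsWithin_le_nhds (Ioi_mem_nhds hx)] with y hy hy0
  exact hy hy0

theorem continuousOn_partialFraction {N : ℕ} (ζ b : Fin N → ℝ) (hζ : ∀ j, 0 < ζ j) (c : ℝ) :
    ContinuousOn (fun x => c + ∑ j, b j / (x + ζ j)) (Set.Ioi 0) := by
  refine continuousOn_const.add (continuousOn_finsetSum _ fun j _ => ?_)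
  refine continuousOn_const.div (by fun_prop) fun x hx => ?_
  have := hζ j
  have : 0 < x := hx
  positivity

/-- The condition `W = q_n / p_n`, tested on the negative half-axis. -/
theorem weyl_eq_iff {N n : ℕ} (ζ b : Fin N → ℝ) (hζ : ∀ j, 0 < ζ j) (hb : ∀ j, 0 < b j) (c : ℝ)
    (g h : Fin n → ℝ) (G H : ℕ → ℝ) (hG : ∀ j : Fin n, G j = g j) (hH : ∀ j : Fin n, H j = h j)
    (hG0 : ∀ k, 0 < G k) (hH0 : ∀ k, 0 < H k) :
    (∀ᶠ z : ℂ in cofinite, weyl (discreteMeasure ζ b) c z =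
      (ivp g h z (Fin.last n)).1 / (ivp g h z (Fin.last n)).2) ↔
    ∀ x, 0 < x → stieltjes (discreteMeasure ζ b) c x * (chain G H n).2.eval x =
      (chain G H n).1.eval x := by
  simp only [ivp_eq_chain g h G H hG hH, weyl_discreteMeasure ζ b hb,
    stieltjes_discreteMeasure ζ b hb, Fin.val_last]
  constructor
  · intro hw x hx
    -- Along the injective map `x ↦ -x` into `ℂ`, a cofinite condition on `z` restricts to a
    -- cofinite condition on real `x`; continuity then fills in the exceptional points.
    have hinj : Function.Injective (fun x : ℝ => (-(x : ℂ))) := fun x y hxy => by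
      simpa using hxy
    have hev := hinj.tendsto_cofinite.eventually hw
    refine eqOn_Ioi_of_cofinite (f₁ := fun x => (c + ∑ j, b j / (x + ζ j)) *
      (chain G H n).2.eval x) (f₂ := fun x => (chain G H n).1.eval x)
      ((continuousOn_partialFraction ζ b hζ c).mul (by fun_prop)) (by fun_prop) ?_ hx
    filter_upwards [hev] with y hy hy0
    have hp := (chain_nonneg_pos hG0 hH0 hy0 n).2
    have hcast : ∀ P : ℝ[X], aeval (y : ℂ) P = ((P.eval y : ℝ) : ℂ) := fun P => by
      have := (aeval_algebraMap_apply (A := ℝ) ℂ y P)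
      simpa using this
    simp only [neg_neg, hcast, sub_neg_eq_add] at hy
    have hy' : c + ∑ j, b j / (y + ζ j) = (chain G H n).1.eval y / (chain G H n).2.eval y := by
      have : ((c + ∑ j, b j / (y + ζ j) : ℝ) : ℂ) =
          (((chain G H n).1.eval y / (chain G H n).2.eval y : ℝ) : ℂ) := by
        push_cast
        rw [← hy]
        simp only [add_comm]
      exact_mod_cast this
    rw [hy']
    field_simp
  · intro hx
    -- Here `R / P` is the partial fraction. Cleared of denominators, equality on the half-axis is a
    -- polynomial identity, which can be evaluated at every complex point outside the zeros of `P`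
    -- and `p_n`.
    set P : ℝ[X] := ∏ j, (X + C (ζ j)) with hP
    set R : ℝ[X] := C c * P + ∑ j, C (b j) * ∏ i ∈ Finset.univ.erase j, (X + C (ζ i)) with hR
    have key : R * (chain G H n).2 = (chain G H n).1 * P := by
      refine eq_of_infinite_eval_eq _ _ ((Set.Ioi_infinite (0 : ℝ)).mono fun x hx0 => ?_)
      have hx0 : 0 < x := hx0
      have hne : ∀ j, x + ζ j ≠ 0 := fun j => by have := hζ j; positivity
      have hRx : R.eval x = (c + ∑ j, b j / (x + ζ j)) * P.eval x := by
        simp only [hR, hP, eval_add, eval_mul, eval_C, eval_finsetSum, eval_prod, eval_X,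
          add_mul, Finset.sum_mul]
        congr 1
        refine Finset.sum_congr rfl fun j _ => ?_
        rw [← Finset.mul_prod_erase Finset.univ _ (Finset.mem_univ j)]
        field_simp [hne j]
      simp only [Set.mem_ofPred_eq, eval_mul, hRx, ← hx x hx0]
      ring
    have hfin : ∀ F : ℝ[X], F ≠ 0 → ∀ᶠ z : ℂ in cofinite, aeval (-z) F ≠ 0 := fun F hF => by
      have hF' : F.map (algebraMap ℝ ℂ) ≠ 0 :=
        (Polynomial.map_ne_zero_iff (algebraMap ℝ ℂ).injective).2 hF
      have h1 : ∀ᶠ z : ℂ in cofinite, ¬ IsRoot (F.map (algebraMap ℝ ℂ)) z := by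
        have := finite_setOfPred_isRoot hF'
        simpa [Filter.eventually_cofinite] using this
      have h2 := (neg_injective (G := ℂ)).tendsto_cofinite.eventually h1
      filter_upwards [h2] with z hz
      simpa [IsRoot, aeval_def, eval_map] using hz
    have hP0 : P ≠ 0 := Finset.prod_ne_zero_iff.2 fun j _ => X_add_C_ne_zero _
    have hp0 : (chain G H n).2 ≠ 0 := fun h0 => by
      have := (chain_nonneg_pos hG0 hH0 one_pos n).2
      simp [h0] at this
    filter_upwards [hfin P hP0, hfin _ hp0] with z hz1 hz2
    have hne : ∀ j, (ζ j : ℂ) - z ≠ 0 := fun j hj => hz1 <| by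
      rw [hP, map_prod]
      exact Finset.prod_eq_zero (Finset.mem_univ j) (by simpa [sub_eq_add_neg, add_comm] using hj)
    have hRz : aeval (-z) R = (c + ∑ j, (b j : ℂ) / (ζ j - z)) * aeval (-z) P := by
      simp only [hR, hP, map_add, map_mul, aeval_C, map_sum, map_prod, aeval_X,
        add_mul, Finset.sum_mul, Complex.coe_algebraMap]
      congr 1
      refine Finset.sum_congr rfl fun j _ => ?_
      rw [← Finset.mul_prod_erase Finset.univ _ (Finset.mem_univ j)]
      have : (ζ j : ℂ) - z = -z + ζ j := by ring
      have h3 := hne j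
      rw [this] at h3 ⊢
      field_simp
    have hk := congrArg (aeval (-z)) key
    rw [map_mul, map_mul, hRz] at hk
    rw [eq_div_iff hz2]
    exact mul_right_cancel₀ hz1 (by linear_combination hk)

/-! ### The left-continuous solution for discrete measures -/

theorem ivp_eq_sum {n : ℕ} (g h : Fin n → ℝ) (z : ℂ) (k : Fin (n + 1)) :
    (ivp g h z k).1 =
      ∑ j : Fin n, (if j.castSucc < k then (h j : ℂ) * (ivp g h z j.castSucc).2 else 0) ∧
    (ivp g h z k).2 =
      1 - z * ∑ j : Fin n, (if j.castSucc < k then (g j : ℂ) * (ivp g h z j.castSucc).1 else 0) := by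
  induction k using Fin.induction with
  | zero => simp [ivp]
  | succ k ih =>
    have e : ivp g h z k.succ = ((ivp g h z k.castSucc).1 + h k * (ivp g h z k.castSucc).2,
        (ivp g h z k.castSucc).2 - z * g k * (ivp g h z k.castSucc).1) := by
      simp [ivp]
    have split : ∀ F : Fin n → ℂ, (∑ j : Fin n, if j.castSucc < k.succ then F j else 0) =
        (∑ j : Fin n, if j.castSucc < k.castSucc then F j else 0) + F k := fun F => by
      have : ∀ j : Fin n, (if j.castSucc < k.succ then F j else 0) =
          (if j.castSucc < k.castSucc then F j else 0) + if j = k then F j else 0 := fun j => by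
        rcases lt_trichotomy j k with h1 | h1 | h1
        · simp [h1, h1.ne, h1.le]
        · simp [h1]
        · simp [h1.ne', h1.not_gt, h1.not_ge]
      simp only [this, Finset.sum_add_distrib, Finset.sum_ite_eq', Finset.mem_univ, if_true]
    rw [split, split, e]
    constructor
    · rw [← ih.1]
    · linear_combination ih.2

theorem isLeftSolution_discreteMeasure_iff {n : ℕ} (y g h : Fin n → ℝ) (hg : ∀ j, 0 ≤ g j)
    (hh : ∀ j, 0 ≤ h j) (z : ℂ) (Φ₁ Φ₂ : ℝ → ℂ) :
    IsLeftSolution (discreteMeasure y g) (discreteMeasure y h) z Φ₁ Φ₂ ↔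
    ∀ t, Φ₁ t = ∑ j, (if y j < t then (h j : ℂ) * Φ₂ (y j) else 0) ∧
      Φ₂ t = 1 - z * ∑ j, (if y j < t then (g j : ℂ) * Φ₁ (y j) else 0) := by
  have key : ∀ (w : Fin n → ℝ) (F : ℝ → ℂ) (t : ℝ), (∀ j, 0 ≤ w j) →
      ∫ ξ in Set.Iio t, F ξ ∂(discreteMeasure y w) =
        ∑ j, if y j < t then (w j : ℂ) * F (y j) else 0 := fun w F t hw => by
    classical
    rw [setIntegral_discreteMeasure y w hw F measurableSet_Iio]
    simp
  simp only [IsLeftSolution, key _ _ _ hg, key _ _ _ hh]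

theorem hasSpectralData_iff {n : ℕ} (m y : Fin n → ℝ) (hm : ∀ j, 0 < m j) (hy : StrictMono y)
    (μ : Measure ℝ) (c : ℝ) :
    HasSpectralData m y μ c ↔ ∀ᶠ z : ℂ in cofinite, weyl μ c z =
      (ivp (fun j => m j * Real.exp (-y j)) (fun j => m j * Real.exp (y j)) z (Fin.last n)).1 /
      (ivp (fun j => m j * Real.exp (-y j)) (fun j => m j * Real.exp (y j)) z (Fin.last n)).2 := by
  have hg : ∀ j, 0 ≤ m j * Real.exp (-y j) := fun j => (mul_pos (hm j) (Real.exp_pos _)).le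
  have hh : ∀ j, 0 ≤ m j * Real.exp (y j) := fun j => (mul_pos (hm j) (Real.exp_pos _)).le
  simp only [HasSpectralData, isLeftSolution_discreteMeasure_iff y _ _ hg hh]
  set g : Fin n → ℝ := fun j => m j * Real.exp (-y j)
  set h : Fin n → ℝ := fun j => m j * Real.exp (y j)
  obtain ⟨T, hT⟩ : ∃ T, ∀ j, y j < T := by
    obtain ⟨T, hT⟩ := (Set.finite_range y).bddAbove
    exact ⟨T + 1, fun j => (hT ⟨j, rfl⟩).trans_lt (lt_add_one T)⟩
  constructor
  · rintro ⟨Φ₁, Φ₂, hΦ, hlim⟩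
    filter_upwards [hlim] with z hz
    -- By left continuity the value at `y j` sees only the atoms strictly to its left, hence the
    -- index `j.castSucc`: the state before site `j` acts.
    have hsite : ∀ k : ℕ, ∀ j : Fin n, (j : ℕ) < k → Φ₁ z (y j) = (ivp g h z j.castSucc).1 ∧
        Φ₂ z (y j) = (ivp g h z j.castSucc).2 := by
      intro k
      induction k with
      | zero => simp
      | succ k ih =>
        intro j hj
        rw [(hΦ z (y j)).1, (hΦ z (y j)).2, (ivp_eq_sum g h z j.castSucc).1,
          (ivp_eq_sum g h z j.castSucc).2]
        have ih' : ∀ i : Fin n, i < j → _ := fun i hij => ih i (by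
          have : (i : ℕ) < j := hij
          omega)
        constructor
        · refine Finset.sum_congr rfl fun i _ => ?_
          simp only [hy.lt_iff_lt, Fin.castSucc_lt_castSucc_iff]
          split_ifs with hij
          · rw [(ih' i hij).2]
          · rfl
        · congr 2
          refine Finset.sum_congr rfl fun i _ => ?_
          simp only [hy.lt_iff_lt, Fin.castSucc_lt_castSucc_iff]
          split_ifs with hij
          · rw [(ih' i hij).1]
          · rfl
    refine tendsto_nhds_unique hz (tendsto_const_nhds.congr' ?_)
    filter_upwards [eventually_ge_atTop T] with t ht
    rw [(hΦ z t).1, (hΦ z t).2, (ivp_eq_sum g h z (Fin.last n)).1,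
      (ivp_eq_sum g h z (Fin.last n)).2]
    simp only [Fin.castSucc_lt_last, if_true, (hT _).trans_le ht, (hsite n _ (Fin.is_lt _)).1,
      (hsite n _ (Fin.is_lt _)).2]
    rfl
  · intro hz
    refine ⟨fun z t => ∑ j, if y j < t then (h j : ℂ) * (ivp g h z j.castSucc).2 else 0,
      fun z t => 1 - z * ∑ j, if y j < t then (g j : ℂ) * (ivp g h z j.castSucc).1 else 0, ?_, ?_⟩
    · intro z t
      have e1 : ∀ j : Fin n, (∑ i, if y i < y j then (h i : ℂ) * (ivp g h z i.castSucc).2 else 0) =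
          (ivp g h z j.castSucc).1 := fun j => by
        rw [(ivp_eq_sum g h z j.castSucc).1]
        simp only [hy.lt_iff_lt, Fin.castSucc_lt_castSucc_iff]
      have e2 : ∀ j : Fin n, (1 - z * ∑ i, if y i < y j then (g i : ℂ) *
          (ivp g h z i.castSucc).1 else 0) = (ivp g h z j.castSucc).2 := fun j => by
        rw [(ivp_eq_sum g h z j.castSucc).2]
        simp only [hy.lt_iff_lt, Fin.castSucc_lt_castSucc_iff]
      simp only [e1, e2]
      exact ⟨rfl, rfl⟩
    · filter_upwards [hz] with z hz
      rw [hz]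
      refine tendsto_const_nhds.congr' ?_
      filter_upwards [eventually_ge_atTop T] with t ht
      rw [(ivp_eq_sum g h z (Fin.last n)).1, (ivp_eq_sum g h z (Fin.last n)).2]
      simp only [Fin.castSucc_lt_last, if_true, (hT _).trans_le ht]

/-! ### Recovering the solution from its Weyl function -/

/-- The function `v.1 + ∑ j, v.2 j / (x + ζ j)`. -/
def pfEval {N : ℕ} (ζ : Fin N → ℝ) (v : ℝ × (Fin N → ℝ)) (x : ℝ) : ℝ :=
  v.1 + ∑ j, v.2 j / (x + ζ j)

/-- Coefficients, with respect to `1` and `1 / (x + ζ j)`, of the functions proportional to `q`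
and `p` that remain after `k` sites have been removed. -/
def peel {N : ℕ} (ζ b : Fin N → ℝ) (c : ℝ) (e : ℕ → ℝ) :
    ℕ → (ℝ × (Fin N → ℝ)) × (ℝ × (Fin N → ℝ))
  | 0 => ((c, b), (1, 0))
  | k + 1 =>
    let s := peel ζ b c e k
    let h := pfEval ζ s.1 (e k) / pfEval ζ s.2 (e k)
    ((0, fun j => (s.1.2 j - h * s.2.2 j) / (e k + ζ j)),
      (s.1.1 / (e k * h), fun j => (s.2.2 j + s.1.2 j * ζ j / (e k * h)) / (e k + ζ j)))

/-- The weight `h` at the `k`-th site from the right. -/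
def peelWeight {N : ℕ} (ζ b : Fin N → ℝ) (c : ℝ) (e : ℕ → ℝ) (k : ℕ) : ℝ :=
  pfEval ζ (peel ζ b c e k).1 (e k) / pfEval ζ (peel ζ b c e k).2 (e k)

/-- Both right-hand sides vanish at `x = e k` by the choice of `peelWeight`, so `e k - x` divides
them; `peel` records the partial fraction coefficients of the quotients. -/
theorem pfEval_peel_succ {N : ℕ} (ζ b : Fin N → ℝ) (c : ℝ) (e : ℕ → ℝ) (k : ℕ)
    (hζ : ∀ j, 0 < ζ j) (he : 0 < e k) (hB : pfEval ζ (peel ζ b c e k).2 (e k) ≠ 0)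
    (hA : pfEval ζ (peel ζ b c e k).1 (e k) ≠ 0) {x : ℝ} (hx : 0 < x) :
    (e k - x) * pfEval ζ (peel ζ b c e (k + 1)).1 x = pfEval ζ (peel ζ b c e k).1 x -
        peelWeight ζ b c e k * pfEval ζ (peel ζ b c e k).2 x ∧
    (e k - x) * pfEval ζ (peel ζ b c e (k + 1)).2 x = pfEval ζ (peel ζ b c e k).2 x -
        x / (e k * peelWeight ζ b c e k) * pfEval ζ (peel ζ b c e k).1 x := by
  have hh : peelWeight ζ b c e k ≠ 0 := div_ne_zero hA hB
  have hroot : pfEval ζ (peel ζ b c e k).1 (e k) =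
      peelWeight ζ b c e k * pfEval ζ (peel ζ b c e k).2 (e k) := by
    rw [peelWeight, div_mul_cancel₀ _ hB]
  have e1 : (peel ζ b c e (k + 1)).1 = (0, fun j => ((peel ζ b c e k).1.2 j -
      peelWeight ζ b c e k * (peel ζ b c e k).2.2 j) / (e k + ζ j)) := rfl
  have e2 : (peel ζ b c e (k + 1)).2 = ((peel ζ b c e k).1.1 / (e k * peelWeight ζ b c e k),
      fun j => ((peel ζ b c e k).2.2 j + (peel ζ b c e k).1.2 j * ζ j /
        (e k * peelWeight ζ b c e k)) / (e k + ζ j)) := rfl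
  rw [e1, e2]
  clear e1 e2 hA hB
  generalize peelWeight ζ b c e k = h at *
  generalize peel ζ b c e k = s at *
  obtain ⟨⟨a0, a⟩, ⟨b0, β⟩⟩ := s
  generalize e k = ε at *
  simp only [pfEval] at hroot ⊢
  have hne : ∀ j, x + ζ j ≠ 0 := fun j => by have := hζ j; positivity
  have hne' : ∀ j, ε + ζ j ≠ 0 := fun j => by have := hζ j; positivity
  constructor
  -- Subtracting the vanishing value at `ε` cancels the constants; each remaining term is divided by
  -- means of `1 / (x + ζ) - 1 / (ε + ζ) = (ε - x) / ((ε + ζ) (x + ζ))`.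
  · have t : (ε - x) * (0 + ∑ j, (a j - h * β j) / (ε + ζ j) / (x + ζ j)) =
        (∑ j, a j / (x + ζ j) - h * ∑ j, β j / (x + ζ j)) -
        (∑ j, a j / (ε + ζ j) - h * ∑ j, β j / (ε + ζ j)) := by
      simp only [zero_add, Finset.mul_sum, ← Finset.sum_sub_distrib]
      refine Finset.sum_congr rfl fun j _ => ?_
      have := hne j; have := hne' j
      field_simp
      ring
    rw [t]; linear_combination -hroot
  · have t : (ε - x) * (a0 / (ε * h) +
          ∑ j, (β j + a j * ζ j / (ε * h)) / (ε + ζ j) / (x + ζ j)) =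
        ((ε - x) * (a0 / (ε * h)) + ∑ j, β j / (x + ζ j) - x / (ε * h) * ∑ j, a j / (x + ζ j)) -
        (∑ j, β j / (ε + ζ j) - ε / (ε * h) * ∑ j, a j / (ε + ζ j)) := by
      simp only [mul_add, Finset.mul_sum, add_sub_assoc, ← Finset.sum_sub_distrib]
      congr 1
      refine Finset.sum_congr rfl fun j _ => ?_
      have := hne j; have := hne' j
      field_simp
      ring
    rw [t]
    have hε : ε ≠ 0 := he.ne'
    field_simp
    linear_combination ε * hroot

theorem continuousOn_pfEval {N : ℕ} (ζ : Fin N → ℝ) (hζ : ∀ j, 0 < ζ j) (v : ℝ × (Fin N → ℝ)) :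
    ContinuousOn (pfEval ζ v) (Set.Ioi 0) :=
  continuousOn_partialFraction ζ v.2 hζ v.1

section Recover

variable {N n : ℕ} {ζ b : Fin N → ℝ} {c : ℝ} {e g h : ℕ → ℝ}

/-- Any solution agrees with the recursion, up to the common factor `p_n ∏ e i`; the product arises
because a step has determinant `(e - x) / e` while `peel` divides by `e - x` only. This gives
uniqueness and the positivity of the denominators in `peelWeight`. -/
theorem chain_eq_peel (hζ : ∀ j, 0 < ζ j) (he : ∀ k, 0 < e k) (hg : ∀ k, 0 < g k)
    (hh : ∀ k, 0 < h k) (hgh : ∀ k < n, g (n - 1 - k) * h (n - 1 - k) * e k = 1)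
    (hW : ∀ x, 0 < x → (c + ∑ j, b j / (x + ζ j)) * (chain g h n).2.eval x =
      (chain g h n).1.eval x) (k : ℕ) (hk : k ≤ n) :
    (∀ x, 0 < x →
      (chain g h (n - k)).1.eval x = (chain g h n).2.eval x * (∏ i ∈ Finset.range k, e i) *
        pfEval ζ (peel ζ b c e k).1 x ∧
      (chain g h (n - k)).2.eval x = (chain g h n).2.eval x * (∏ i ∈ Finset.range k, e i) *
        pfEval ζ (peel ζ b c e k).2 x) ∧
    (k < n → h (n - 1 - k) = peelWeight ζ b c e k ∧ 0 < pfEval ζ (peel ζ b c e k).1 (e k) ∧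
      0 < pfEval ζ (peel ζ b c e k).2 (e k)) := by
  -- At the node `e k` the step determinant is zero, so inverting the step reads `q = h p`, which
  -- determines `h`.
  have hlast : ∀ k, k < n → (∀ x, 0 < x →
      (chain g h (n - k)).1.eval x = (chain g h n).2.eval x * (∏ i ∈ Finset.range k, e i) *
        pfEval ζ (peel ζ b c e k).1 x ∧
      (chain g h (n - k)).2.eval x = (chain g h n).2.eval x * (∏ i ∈ Finset.range k, e i) *
        pfEval ζ (peel ζ b c e k).2 x) →
      h (n - 1 - k) = peelWeight ζ b c e k ∧ 0 < pfEval ζ (peel ζ b c e k).1 (e k) ∧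
        0 < pfEval ζ (peel ζ b c e k).2 (e k) := by
    intro k hk hx
    obtain ⟨h1, h2⟩ := hx (e k) (he k)
    have hP := (chain_nonneg_pos hg hh (he k) n).2
    have hE : 0 < ∏ i ∈ Finset.range k, e i := Finset.prod_pos fun i _ => he i
    have hj : n - k = n - 1 - k + 1 := by omega
    have hb := chain_fst_back g h (e k) (n - 1 - k)
    rw [← hj] at hb
    have hq : 0 < (chain g h (n - k)).1.eval (e k) := by
      rw [hj]; exact chain_fst_succ_pos hg hh (he k) _
    have hp := (chain_nonneg_pos hg hh (he k) (n - k)).2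
    rw [h1] at hq
    rw [h2] at hp
    have hPE := mul_pos hP hE
    have hA := pos_of_mul_pos_right hq hPE.le
    have hB := pos_of_mul_pos_right hp hPE.le
    refine ⟨?_, hA, hB⟩
    rw [peelWeight, eq_div_iff hB.ne']
    refine mul_left_cancel₀ hPE.ne' ?_
    rw [h1, h2] at hb
    have := hgh k hk
    have h0 : 1 - e k * (g (n - 1 - k) * h (n - 1 - k)) = 0 := by linear_combination -this
    rw [h0, mul_zero] at hb
    linear_combination -hb
  have hfirst : ∀ x, 0 < x →
      (chain g h (n - k)).1.eval x = (chain g h n).2.eval x * (∏ i ∈ Finset.range k, e i) *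
        pfEval ζ (peel ζ b c e k).1 x ∧
      (chain g h (n - k)).2.eval x = (chain g h n).2.eval x * (∏ i ∈ Finset.range k, e i) *
        pfEval ζ (peel ζ b c e k).2 x := by
    induction k with
    | zero =>
      intro x hx
      have := hW x hx
      constructor
      · rw [Nat.sub_zero, ← this]; simp [peel, pfEval, mul_comm]
      · simp [peel, pfEval]
    | succ k ih =>
      have ih := ih (by omega)
      obtain ⟨hhk, hA, hB⟩ := hlast k (by omega) ih
      have hj : n - k = n - 1 - k + 1 := by omega
      have hj' : n - (k + 1) = n - 1 - k := by omega
      have hgk := hgh k (by omega)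
      rw [hj']
      rw [hj] at ih
      have hpeel := fun x hx => pfEval_peel_succ ζ b c e k hζ (he k) hB.ne' hA.ne' (x := x) hx
      rw [← hhk] at hpeel
      -- Cancelling `e k - x` is legitimate away from the node; continuity recovers the identity at
      -- the node.
      have hcof : ∀ᶠ x : ℝ in cofinite, x ≠ e k := by simp [Filter.eventually_cofinite]
      have hek := (he k).ne'
      have hhk0 := (hh (n - 1 - k)).ne'
      have hgval : g (n - 1 - k) = 1 / (e k * h (n - 1 - k)) := by
        field_simp; linear_combination hgk
      intro x hx
      constructor
      · refine eqOn_Ioi_of_cofinite (f₁ := fun x => (chain g h (n - 1 - k)).1.eval x)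
          (f₂ := fun x => (chain g h n).2.eval x * (∏ i ∈ Finset.range (k + 1), e i) *
            pfEval ζ (peel ζ b c e (k + 1)).1 x) (by fun_prop)
          ((by fun_prop : ContinuousOn _ _).mul (continuousOn_pfEval ζ hζ _)) ?_ hx
        filter_upwards [hcof] with y hy hy0
        have hb := chain_fst_back g h y (n - 1 - k)
        rw [(ih y hy0).1, (ih y hy0).2] at hb
        refine mul_left_cancel₀ (sub_ne_zero.2 hy.symm) ?_
        rw [Finset.prod_range_succ]
        linear_combination (-(e k)) * hb + (-(chain g h n).2.eval y *
          (∏ i ∈ Finset.range k, e i) * e k) * (hpeel y hy0).1 +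
          (chain g h (n - 1 - k)).1.eval y * y * hgk
      · refine eqOn_Ioi_of_cofinite (f₁ := fun x => (chain g h (n - 1 - k)).2.eval x)
          (f₂ := fun x => (chain g h n).2.eval x * (∏ i ∈ Finset.range (k + 1), e i) *
            pfEval ζ (peel ζ b c e (k + 1)).2 x) (by fun_prop)
          ((by fun_prop : ContinuousOn _ _).mul (continuousOn_pfEval ζ hζ _)) ?_ hx
        filter_upwards [hcof] with y hy hy0
        have hb := chain_snd_back g h y (n - 1 - k)
        rw [(ih y hy0).1, (ih y hy0).2] at hb
        refine mul_left_cancel₀ (sub_ne_zero.2 hy.symm) ?_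
        rw [Finset.prod_range_succ]
        have h2 := (hpeel y hy0).2
        rw [← mul_one_div y, ← hgval] at h2
        linear_combination (-(e k)) * hb + (-(chain g h n).2.eval y *
          (∏ i ∈ Finset.range k, e i) * e k) * h2 +
          (chain g h (n - 1 - k)).2.eval y * y * hgk
  exact ⟨hfirst, fun hkn => hlast k hkn hfirst⟩

end Recover

/-! ### Determinant formulas -/

/-- If a combination of the columns, in which the `j₀`-th column has coefficient one, vanishes
outside the last row, then the determinant reduces to a minor. -/
theorem abs_det_of_column_combination {k : ℕ} (M : Matrix (Fin (k + 1)) (Fin (k + 1)) ℝ)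
    (a : Fin (k + 1) → ℝ) (j₀ : Fin (k + 1)) (hj₀ : a j₀ = 1)
    (hM : ∀ i : Fin k, ∑ j, a j * M i.castSucc j = 0) :
    |M.det| = |∑ j, a j * M (Fin.last k) j| *
      |(M.submatrix Fin.castSucc j₀.succAbove).det| := by
  have h1 := Matrix.det_updateCol_sum M j₀ a
  rw [hj₀, one_smul] at h1
  rw [← h1, Matrix.det_succ_column _ j₀, Fin.sum_univ_castSucc, Finset.sum_eq_zero]
  · simp only [zero_add, Matrix.updateCol_self, smul_eq_mul, abs_mul, abs_pow, abs_neg, abs_one,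
      one_pow, one_mul, Fin.succAbove_last]
    congr 3
    ext i j
    simp
  · intro i _
    have := hM i
    simp only [Matrix.updateCol_self, smul_eq_mul, this, mul_zero, zero_mul]

/-- Column combinations of a `CSV` matrix are the values at the nodes of functions `y^p A(y) ν̂_c(y)
+ B(y)`, with `A` and `B` polynomials of bounded degree. -/
theorem csv_row_combination {k l d : ℕ} (hk : k = l + d) (p : ℕ) (e : Fin k → ℝ)
    (ν : Measure ℝ) (c : ℝ) (i : Fin k) (a b : ℕ → ℝ) :
    ∑ j : Fin k, (if (j : ℕ) < l then a j else b ((j : ℕ) - l)) * csv k l p e ν c i j =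
      e i ^ p * (∑ j ∈ Finset.range l, a j * e i ^ j) * stieltjes ν c (e i) +
      ∑ j ∈ Finset.range d, b j * e i ^ j := by
  subst hk
  have h1 : ∀ j : Fin (l + d),
      (if (j : ℕ) < l then a j else b ((j : ℕ) - l)) * csv (l + d) l p e ν c i j =
      if (j : ℕ) < l then a j * (e i ^ (p + (j : ℕ)) * stieltjes ν c (e i))
        else b ((j : ℕ) - l) * e i ^ ((j : ℕ) - l) := fun j => by
    simp only [csv, Matrix.of_apply]
    split_ifs <;> rfl
  rw [Finset.sum_congr rfl fun j _ => h1 j, Fin.sum_univ_eq_sum_range (fun j : ℕ =>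
      if j < l then a j * (e i ^ (p + j) * stieltjes ν c (e i)) else b (j - l) * e i ^ (j - l)),
    Finset.sum_range_add, Finset.mul_sum, Finset.sum_mul]
  congr 1
  · refine Finset.sum_congr rfl fun j hj => ?_
    rw [if_pos (Finset.mem_range.1 hj)]
    ring
  · refine Finset.sum_congr rfl fun j _ => ?_
    simp

theorem eval_eq_sum_range_of_coeff {P : ℝ[X]} {d : ℕ} (hP : ∀ j, d ≤ j → P.coeff j = 0) (x : ℝ) :
    P.eval x = ∑ j ∈ Finset.range d, P.coeff j * x ^ j := by
  rw [eval_eq_sum_range' (n := d + P.natDegree + 1) (by omega)]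
  refine (Finset.sum_subset (fun j hj => ?_) fun j _ hj => ?_).symm
  · simp only [Finset.mem_range] at hj ⊢; omega
  · rw [hP j (by simpa using hj), zero_mul]

/-- Removing `k` sites from the right acts on `(q_n, p_n)` by polynomials. -/
theorem exists_back_polynomials (g h : ℕ → ℝ) (n k : ℕ) (hk : k ≤ n) :
    ∃ α β γ δ : ℝ[X], α.coeff 0 = 1 ∧ δ.coeff 0 = 1 ∧
      (∀ j, k / 2 + 1 ≤ j → α.coeff j = 0) ∧ (∀ j, (k + 1) / 2 ≤ j → β.coeff j = 0) ∧
      (∀ j, (k + 1) / 2 ≤ j → γ.coeff j = 0) ∧ (∀ j, k / 2 + 1 ≤ j → δ.coeff j = 0) ∧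
      ∀ x,
        (chain g h (n - k)).1.eval x *
            ∏ i ∈ Finset.range k, (1 - x * (g (n - 1 - i) * h (n - 1 - i))) =
          α.eval x * (chain g h n).1.eval x + β.eval x * (chain g h n).2.eval x ∧
        (chain g h (n - k)).2.eval x *
            ∏ i ∈ Finset.range k, (1 - x * (g (n - 1 - i) * h (n - 1 - i))) =
          x * γ.eval x * (chain g h n).1.eval x + δ.eval x * (chain g h n).2.eval x := by
  induction k with
  | zero =>
    refine ⟨1, 0, 0, 1, by simp, by simp, fun j hj => ?_, by simp, by simp, fun j hj => ?_,
      by simp⟩ <;>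
    · rw [coeff_one, if_neg (by omega)]
  | succ k ih =>
    obtain ⟨α, β, γ, δ, hα0, hδ0, hα, hβ, hγ, hδ, hx⟩ := ih (by omega)
    -- Left multiplication by the adjugate step, with rows `(1, -h)` and `(-x g, 1)`. Keeping the
    -- lower left entry as `x γ` makes the two pairs of degree bounds grow alternately.
    refine ⟨α - C (h (n - 1 - k)) * (X * γ), β - C (h (n - 1 - k)) * δ,
      γ - C (g (n - 1 - k)) * α, δ - C (g (n - 1 - k)) * (X * β), by simp [hα0], by simp [hδ0],
      ?_, ?_, ?_, ?_, ?_⟩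
    · intro j hj
      obtain ⟨i, rfl⟩ : ∃ i, j = i + 1 := ⟨j - 1, by omega⟩
      rw [coeff_sub, coeff_C_mul, coeff_X_mul, hα _ (by omega), hγ _ (by omega)]; simp
    · intro j hj
      rw [coeff_sub, coeff_C_mul, hβ _ (by omega), hδ _ (by omega)]; simp
    · intro j hj
      rw [coeff_sub, coeff_C_mul, hγ _ (by omega), hα _ (by omega)]; simp
    · intro j hj
      obtain ⟨i, rfl⟩ : ∃ i, j = i + 1 := ⟨j - 1, by omega⟩
      rw [coeff_sub, coeff_C_mul, coeff_X_mul, hδ _ (by omega), hβ _ (by omega)]; simp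
    · intro x
      obtain ⟨h1, h2⟩ := hx x
      have b1 := chain_fst_back g h x (n - 1 - k)
      have b2 := chain_snd_back g h x (n - 1 - k)
      rw [show n - 1 - k + 1 = n - k by omega] at b1 b2
      rw [show n - (k + 1) = n - 1 - k by omega, Finset.prod_range_succ]
      simp only [eval_sub, eval_mul, eval_C, eval_X]
      generalize (∏ i ∈ Finset.range k, (1 - x * (g (n - 1 - i) * h (n - 1 - i)))) = T at *
      constructor
      · linear_combination (-T) * b1 + h1 - h (n - 1 - k) * h2
      · linear_combination (-T) * b2 + h2 - x * g (n - 1 - k) * h1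

section Determinants

variable {n : ℕ} {ν : Measure ℝ} {c : ℝ} {e g h : ℕ → ℝ}

theorem csv_submatrix_zero (k l : ℕ) (e : ℕ → ℝ) (ν : Measure ℝ) (c : ℝ) :
    (csv (k + 1) (l + 1) 0 (fun i => e i) ν c).submatrix Fin.castSucc
      (0 : Fin (k + 1)).succAbove = csv k l 1 (fun i => e i) ν c := by
  ext i j
  simp [csv, add_comm]

/-- Once the column of ones is deleted, every remaining entry of row `i` contains a factor `e i`. -/
theorem csv_submatrix_mid (k l : ℕ) (hl : l < k + 1) (e : ℕ → ℝ) (ν : Measure ℝ) (c : ℝ) :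
    (csv (k + 1) l 1 (fun i => e i) ν c).submatrix Fin.castSucc
      (⟨l, hl⟩ : Fin (k + 1)).succAbove =
      Matrix.of fun (i : Fin k) j => e i * csv k l 0 (fun i => e i) ν c i j := by
  ext i j
  simp only [csv, Matrix.submatrix_apply, Matrix.of_apply, Fin.succAbove, Fin.lt_def,
    Fin.val_castSucc]
  by_cases hj : (j : ℕ) < l
  · simp [hj, pow_add, mul_assoc]
  · have : (j : ℕ) + 1 - l = (j : ℕ) - l + 1 := by omega
    have h2 : ¬ (j : ℕ) + 1 < l := by omega
    simp [hj, this, h2, pow_succ, mul_comm]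

/-- The coefficients of the back polynomials combine the columns to zero in the first `k` rows. The
coefficient equal to one is `α.coeff 0` (first column), respectively `δ.coeff 0` (column of ones),
and this is the column deleted in the minor. The floor halves cover both parities at once. -/
theorem abs_det_csv_succ (hg : ∀ k, 0 < g k) (hh : ∀ k, 0 < h k) (he : ∀ k, 0 < e k)
    (hgh : ∀ k < n, g (n - 1 - k) * h (n - 1 - k) * e k = 1)
    (hW : ∀ x, 0 < x → stieltjes ν c x * (chain g h n).2.eval x = (chain g h n).1.eval x)
    (k : ℕ) (hk : k < n) :
    |(csv (k + 1) (k / 2 + 1) 0 (fun i => e i) ν c).det| =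
      (chain g h (n - k)).1.eval (e k) *
        |∏ i ∈ Finset.range k, (1 - e k * (g (n - 1 - i) * h (n - 1 - i)))| /
        (chain g h n).2.eval (e k) * |(csv k (k / 2) 1 (fun i => e i) ν c).det| ∧
    |(csv (k + 1) ((k + 1) / 2) 1 (fun i => e i) ν c).det| =
      (chain g h (n - k)).2.eval (e k) *
        |∏ i ∈ Finset.range k, (1 - e k * (g (n - 1 - i) * h (n - 1 - i)))| /
        (chain g h n).2.eval (e k) *
        ((∏ i ∈ Finset.range k, e i) * |(csv k ((k + 1) / 2) 0 (fun i => e i) ν c).det|) := by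
  obtain ⟨α, β, γ, δ, hα0, hδ0, hα, hβ, hγ, hδ, hx⟩ := exists_back_polynomials g h n k hk.le
  have hp : ∀ x, 0 < x → 0 < (chain g h n).2.eval x := fun x hx =>
    (chain_nonneg_pos hg hh hx n).2
  have hz : ∀ i : Fin k,
      ∏ l ∈ Finset.range k, (1 - e i * (g (n - 1 - l) * h (n - 1 - l))) = 0 := fun i => by
    refine Finset.prod_eq_zero (Finset.mem_range.2 i.2) ?_
    linear_combination -(hgh i (i.2.trans hk))
  have v1 : ∀ x, 0 < x → α.eval x * stieltjes ν c x + β.eval x =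
      (chain g h (n - k)).1.eval x *
        (∏ i ∈ Finset.range k, (1 - x * (g (n - 1 - i) * h (n - 1 - i)))) /
        (chain g h n).2.eval x := fun x h0 => by
    rw [eq_div_iff (hp x h0).ne', (hx x).1, ← hW x h0]; ring
  have v2 : ∀ x, 0 < x → x * γ.eval x * stieltjes ν c x + δ.eval x =
      (chain g h (n - k)).2.eval x *
        (∏ i ∈ Finset.range k, (1 - x * (g (n - 1 - i) * h (n - 1 - i)))) /
        (chain g h n).2.eval x := fun x h0 => by
    rw [eq_div_iff (hp x h0).ne', (hx x).2, ← hW x h0]; ring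
  have r1 : ∀ i : Fin (k + 1), ∑ j : Fin (k + 1),
      (if (j : ℕ) < k / 2 + 1 then α.coeff j else β.coeff ((j : ℕ) - (k / 2 + 1))) *
      csv (k + 1) (k / 2 + 1) 0 (fun i => e i) ν c i j =
      (chain g h (n - k)).1.eval (e i) *
        (∏ l ∈ Finset.range k, (1 - e i * (g (n - 1 - l) * h (n - 1 - l)))) /
        (chain g h n).2.eval (e i) := fun i => by
    rw [csv_row_combination (d := (k + 1) / 2) (by omega), ← eval_eq_sum_range_of_coeff hα,
      ← eval_eq_sum_range_of_coeff hβ, ← v1 _ (he _)]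
    ring
  have r2 : ∀ i : Fin (k + 1), ∑ j : Fin (k + 1),
      (if (j : ℕ) < (k + 1) / 2 then γ.coeff j else δ.coeff ((j : ℕ) - (k + 1) / 2)) *
      csv (k + 1) ((k + 1) / 2) 1 (fun i => e i) ν c i j =
      (chain g h (n - k)).2.eval (e i) *
        (∏ l ∈ Finset.range k, (1 - e i * (g (n - 1 - l) * h (n - 1 - l)))) /
        (chain g h n).2.eval (e i) := fun i => by
    rw [csv_row_combination (d := k / 2 + 1) (by omega), ← eval_eq_sum_range_of_coeff hγ,
      ← eval_eq_sum_range_of_coeff hδ, ← v2 _ (he _)]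
    ring
  have nn := chain_nonneg_pos hg hh (he k) (n - k)
  constructor
  · rw [abs_det_of_column_combination _ (fun j => if (j : ℕ) < k / 2 + 1 then α.coeff j
      else β.coeff ((j : ℕ) - (k / 2 + 1))) 0 (by simpa using hα0) fun i => by
      rw [r1, Fin.val_castSucc, hz i]; simp, r1, csv_submatrix_zero, Fin.val_last, abs_div,
      abs_mul, abs_of_nonneg nn.1, abs_of_pos (hp _ (he k))]
  · rw [abs_det_of_column_combination _ (fun j => if (j : ℕ) < (k + 1) / 2 then γ.coeff j
      else δ.coeff ((j : ℕ) - (k + 1) / 2)) ⟨(k + 1) / 2, by omega⟩ (by simpa using hδ0) fun i => by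
      rw [r2, Fin.val_castSucc, hz i]; simp, r2, csv_submatrix_mid, Fin.val_last, abs_div,
      abs_mul, abs_of_nonneg nn.2.le, abs_of_pos (hp _ (he k)), Matrix.det_mul_column, abs_mul,
      Fin.prod_univ_eq_prod_range, abs_of_pos (Finset.prod_pos fun i _ => he i)]

/-- In the recursion of `abs_det_csv_succ` every factor is positive, the product of step
determinants being nonzero at `e k` because the nodes are distinct. -/
theorem abs_det_csv_pos (hg : ∀ k, 0 < g k) (hh : ∀ k, 0 < h k) (he : ∀ k, 0 < e k)
    (hgh : ∀ k < n, g (n - 1 - k) * h (n - 1 - k) * e k = 1)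
    (hinj : ∀ i j, i < n → j < n → e i = e j → i = j)
    (hW : ∀ x, 0 < x → stieltjes ν c x * (chain g h n).2.eval x = (chain g h n).1.eval x)
    (k : ℕ) (hk : k ≤ n) :
    0 < |(csv k ((k + 1) / 2) 0 (fun i => e i) ν c).det| ∧
    0 < |(csv k (k / 2) 1 (fun i => e i) ν c).det| := by
  induction k with
  | zero => simp
  | succ k ih =>
    obtain ⟨ih1, ih2⟩ := ih (by omega)
    obtain ⟨s1, s2⟩ := abs_det_csv_succ hg hh he hgh hW k hk
    have hq : 0 < (chain g h (n - k)).1.eval (e k) := by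
      rw [show n - k = n - 1 - k + 1 by omega]
      exact chain_fst_succ_pos hg hh (he k) _
    have hp := (chain_nonneg_pos hg hh (he k) (n - k)).2
    have hP := (chain_nonneg_pos hg hh (he k) n).2
    have hE : 0 < ∏ i ∈ Finset.range k, e i := Finset.prod_pos fun i _ => he i
    have hV : 0 < |∏ i ∈ Finset.range k, (1 - e k * (g (n - 1 - i) * h (n - 1 - i)))| := by
      refine abs_pos.2 (Finset.prod_ne_zero_iff.2 fun i hi h0 => ?_)
      have hi := Finset.mem_range.1 hi
      have hii := hgh i (by omega)
      have : e i = e k := by linear_combination e k * hii + e i * h0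
      have := hinj i k (by omega) (by omega) this
      omega
    rw [show (k + 1 + 1) / 2 = k / 2 + 1 by omega, s1, s2]
    constructor <;> positivity

/-- In the quotient of the two recursions everything cancels except the smaller minors, the node
product and `q_{n-k}(e_k) / p_{n-k}(e_k)`, which is the weight. -/
theorem weight_eq_det (hg : ∀ k, 0 < g k) (hh : ∀ k, 0 < h k) (he : ∀ k, 0 < e k)
    (hgh : ∀ k < n, g (n - 1 - k) * h (n - 1 - k) * e k = 1)
    (hinj : ∀ i j, i < n → j < n → e i = e j → i = j)
    (hW : ∀ x, 0 < x → stieltjes ν c x * (chain g h n).2.eval x = (chain g h n).1.eval x)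
    (k : ℕ) (hk : k < n) :
    h (n - 1 - k) = (∏ i ∈ Finset.range k, e i) *
      |(csv (k + 1) ((k + 2) / 2) 0 (fun i => e i) ν c).det| *
      |(csv k ((k + 1) / 2) 0 (fun i => e i) ν c).det| /
      (|(csv (k + 1) ((k + 1) / 2) 1 (fun i => e i) ν c).det| *
      |(csv k (k / 2) 1 (fun i => e i) ν c).det|) := by
  obtain ⟨s1, s2⟩ := abs_det_csv_succ hg hh he hgh hW k hk
  obtain ⟨p1, p2⟩ := abs_det_csv_pos hg hh he hgh hinj hW k hk.le
  obtain ⟨p3, p4⟩ := abs_det_csv_pos hg hh he hgh hinj hW (k + 1) hk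
  have hb := chain_fst_back g h (e k) (n - 1 - k)
  rw [show n - 1 - k + 1 = n - k by omega] at hb
  have h0 : 1 - e k * (g (n - 1 - k) * h (n - 1 - k)) = 0 := by linear_combination -(hgh k hk)
  rw [h0, mul_zero] at hb
  rw [eq_div_iff (mul_pos p4 p2).ne', show (k + 2) / 2 = k / 2 + 1 by omega, s1, s2]
  have hP := (chain_nonneg_pos hg hh (he k) n).2
  rw [sub_eq_zero.1 hb]
  ring

end Determinants

/-! ### Partial fractions with interlacing poles -/

/-- A polynomial of degree at most `M` is determined by its `M`-th coefficient and its values at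
`M` points. -/
theorem eq_nodal_of_eval_eq_zero {M : ℕ} {η : Fin M → ℝ} (hη : Function.Injective η) {K : ℝ[X]}
    (hK : ∀ m, M < m → K.coeff m = 0) (hroot : ∀ j, K.eval (η j) = 0) :
    K = C (K.coeff M) * Lagrange.nodal Finset.univ η := by
  refine sub_eq_zero.1 (eq_zero_of_degree_lt_of_eval_index_eq_zero Finset.univ
    hη.injOn ?_ fun i _ => ?_)
  · rw [Finset.card_univ, Fintype.card_fin, degree_lt_iff_coeff_zero]
    intro m hm
    have hn : (Lagrange.nodal Finset.univ η).natDegree = M := by simp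
    rw [coeff_sub, coeff_C_mul]
    rcases hm.eq_or_lt with rfl | hm
    · have h1 := (Lagrange.nodal_monic (s := Finset.univ) (v := η)).coeff_natDegree
      rw [hn] at h1
      rw [h1]; ring
    · rw [hK m hm, coeff_eq_zero_of_natDegree_lt (hn.trans_lt hm)]; ring
  · rw [eval_sub, hroot, eval_mul, Lagrange.eval_nodal_at_node (Finset.mem_univ i)]
    ring

/-- Partial fractions from Lagrange interpolation: `F` minus its interpolant vanishes at all nodes,
so it is a constant multiple of the nodal polynomial. -/
theorem eval_div_nodal {M : ℕ} {η : Fin M → ℝ} (hη : Function.Injective η) {F : ℝ[X]}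
    (hF : ∀ m, M < m → F.coeff m = 0) {z : ℝ} (hz : ∀ j, z ≠ η j) :
    F.eval z = (F.coeff M + ∑ j, Lagrange.nodalWeight Finset.univ η j * F.eval (η j) /
      (z - η j)) * (Lagrange.nodal Finset.univ η).eval z := by
  set G := F - Lagrange.interpolate Finset.univ η (fun i => F.eval (η i)) with hG
  have hdeg : (Lagrange.interpolate Finset.univ η (fun i => F.eval (η i))).degree < M := by
    simpa using Lagrange.degree_interpolate_lt (s := Finset.univ) (fun i => F.eval (η i)) hη.injOn
  have hcoeff := (degree_lt_iff_coeff_zero _ _).1 hdeg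
  have h1 := eq_nodal_of_eval_eq_zero hη (K := G)
    (fun m hm => by rw [hG, coeff_sub, hF m hm, hcoeff m hm.le, sub_zero])
    (fun j => by
      rw [hG, eval_sub, Lagrange.eval_interpolate_at_node _ hη.injOn (Finset.mem_univ j), sub_self])
  have h2 : G.coeff M = F.coeff M := by rw [hG, coeff_sub, hcoeff M le_rfl, sub_zero]
  rw [h2] at h1
  have h3 := congrArg (eval z) h1
  rw [hG, eval_sub, eval_mul, eval_C, Lagrange.eval_interpolate_not_at_node _
    (fun i _ => hz i)] at h3
  have h4 : ∑ j, Lagrange.nodalWeight Finset.univ η j * F.eval (η j) / (z - η j) =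
      ∑ j, Lagrange.nodalWeight Finset.univ η j * (z - η j)⁻¹ * F.eval (η j) :=
    Finset.sum_congr rfl fun j _ => by rw [div_eq_mul_inv]; ring
  rw [h4]
  linear_combination h3

/-- The polynomial `∑ j, w j ∏_{i ≠ j} (z - ζ i)`. -/
def pfNumer {N : ℕ} (ζ w : Fin N → ℝ) : ℝ[X] :=
  ∑ j, C (w j) * Lagrange.nodal (Finset.univ.erase j) ζ

section PfNumer

variable {N : ℕ} (ζ w : Fin N → ℝ)

theorem coeff_pfNumer (m : ℕ) (hm : N ≤ m) : (pfNumer ζ w).coeff m = 0 := by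
  rw [pfNumer, finsetSum_coeff]
  refine Finset.sum_eq_zero fun j _ => ?_
  have hN : 0 < N := j.pos
  rw [coeff_C_mul, coeff_eq_zero_of_natDegree_lt, mul_zero]
  rw [Lagrange.natDegree_nodal, Finset.card_erase_of_mem (Finset.mem_univ j)]
  simp
  omega

theorem coeff_pfNumer_pred {M : ℕ} (ζ w : Fin (M + 1) → ℝ) :
    (pfNumer ζ w).coeff M = ∑ j, w j := by
  rw [pfNumer, finsetSum_coeff]
  refine Finset.sum_congr rfl fun j _ => ?_
  have h1 := (Lagrange.nodal_monic (s := Finset.univ.erase j) (v := ζ)).coeff_natDegree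
  rw [Lagrange.natDegree_nodal, Finset.card_erase_of_mem (Finset.mem_univ j)] at h1
  simp only [Finset.card_univ, Fintype.card_fin, Nat.add_sub_cancel] at h1
  rw [coeff_C_mul, h1, mul_one]

theorem eval_pfNumer_node (j : Fin N) :
    (pfNumer ζ w).eval (ζ j) = w j * ∏ i ∈ Finset.univ.erase j, (ζ j - ζ i) := by
  rw [pfNumer, eval_finsetSum, Finset.sum_eq_single j]
  · rw [eval_mul, eval_C, Lagrange.eval_nodal]
  · intro i _ hij
    rw [eval_mul, Lagrange.eval_nodal_at_node (by simpa using hij.symm), mul_zero]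
  · simp

theorem eval_pfNumer_neg {x : ℝ} (hx : ∀ j, x + ζ j ≠ 0) :
    (pfNumer ζ w).eval (-x) =
      -(Lagrange.nodal Finset.univ ζ).eval (-x) * ∑ j, w j / (x + ζ j) := by
  rw [pfNumer, eval_finsetSum, Finset.mul_sum]
  refine Finset.sum_congr rfl fun j _ => ?_
  rw [eval_mul, eval_C, Lagrange.nodal_eq_mul_nodal_erase (Finset.mem_univ j), eval_mul]
  have := hx j
  simp only [eval_sub, eval_X, eval_C]
  field_simp
  ring

/-- At a root of the denominator built from the weights `w j * ζ j`, this expresses the numerator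
through the nodal polynomial, whose sign interlacing determines. -/
theorem X_mul_pfNumer :
    X * pfNumer ζ w =
      pfNumer ζ (fun j => w j * ζ j) + C (∑ j, w j) * Lagrange.nodal Finset.univ ζ := by
  simp only [pfNumer, Finset.mul_sum, map_sum, Finset.sum_mul, ← Finset.sum_add_distrib]
  refine Finset.sum_congr rfl fun j _ => ?_
  rw [Lagrange.nodal_eq_mul_nodal_erase (Finset.mem_univ j), C_mul]
  ring

end PfNumer

theorem exists_root_of_mul_neg {K : ℝ[X]} {a b : ℝ} (hab : a < b)
    (h : K.eval a * K.eval b < 0) : ∃ x, a < x ∧ x < b ∧ K.eval x = 0 := by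
  rcases mul_neg_iff.1 h with ⟨ha, hb⟩ | ⟨ha, hb⟩
  · obtain ⟨x, hx, h0⟩ := intermediate_value_Ioo' hab.le
      (f := fun x => K.eval x) (by fun_prop) ⟨hb, ha⟩
    exact ⟨x, hx.1, hx.2, h0⟩
  · obtain ⟨x, hx, h0⟩ := intermediate_value_Ioo hab.le
      (f := fun x => K.eval x) (by fun_prop) ⟨ha, hb⟩
    exact ⟨x, hx.1, hx.2, h0⟩

/-- No node lies between two consecutive ones, so the factors from any third node have equal signs;
only the mutual differences have opposite signs. Hence a `pfNumer` with positive weights changes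
sign across each gap. -/
theorem prod_sub_mul_prod_sub_neg {N : ℕ} {ζ : Fin N → ℝ} (hζ : StrictMono ζ) {j j' : Fin N}
    (hj : (j' : ℕ) = j + 1) :
    (∏ i ∈ Finset.univ.erase j, (ζ j - ζ i)) * ∏ i ∈ Finset.univ.erase j', (ζ j' - ζ i) < 0 := by
  have hlt : j < j' := Fin.lt_def.2 (by omega)
  rw [← Finset.mul_prod_erase (Finset.univ.erase j) _ (a := j') (by simp [hlt.ne']),
    ← Finset.mul_prod_erase (Finset.univ.erase j') _ (a := j) (by simp [hlt.ne]),
    Finset.erase_right_comm (a := j')]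
  have h1 : 0 < (∏ i ∈ (Finset.univ.erase j).erase j', (ζ j - ζ i)) *
      ∏ i ∈ (Finset.univ.erase j).erase j', (ζ j' - ζ i) := by
    rw [← Finset.prod_mul_distrib]
    refine Finset.prod_pos fun i hi => ?_
    simp only [Finset.mem_erase, Finset.mem_univ, and_true, ne_eq, Fin.ext_iff] at hi
    rcases lt_or_gt_of_ne hi.2 with h | h
    · have h2 := hζ (show i < j from h)
      have h3 := hζ hlt
      exact mul_pos (by linarith) (by linarith)
    · have h2 := hζ (show j' < i from Fin.lt_def.2 (by omega))
      have h3 := hζ hlt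
      exact mul_pos_of_neg_of_neg (by linarith) (by linarith)
  have h3 := hζ hlt
  have h4 : (ζ j - ζ j') * (ζ j' - ζ j) < 0 := mul_neg_of_neg_of_pos (by linarith) (by linarith)
  calc _ = ((ζ j - ζ j') * (ζ j' - ζ j)) * _ := by ring
    _ < 0 := mul_neg_of_neg_of_pos h4 h1

/-- The quotient of two Stieltjes transforms as a Stieltjes transform, with a positive constant
term in the denominator. -/
theorem exists_quotient_of_pos {N : ℕ} (ζ w : Fin N → ℝ) (hζ0 : ∀ j, 0 < ζ j)
    (hζ : StrictMono ζ) (hw : ∀ j, 0 < w j) {c : ℝ} (hc : 0 < c) :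
    ∃ η β : Fin N → ℝ, (∀ j, 0 < η j) ∧ StrictMono η ∧ (∀ j, 0 < β j) ∧
      ∀ x, 0 < x → (∑ j, β j / (x + η j)) * (c + ∑ j, w j * ζ j / (x + ζ j)) =
        ∑ j, w j / (x + ζ j) := by
  set F := pfNumer ζ w with hF
  -- In the variable `-x`, the polynomials `F` and `K` are the numerator and the denominator of the
  -- quotient, both multiplied by `-∏ (-x - ζ j)`.
  set K := pfNumer ζ (fun j => w j * ζ j) - C c * Lagrange.nodal Finset.univ ζ with hK
  have hnd : (Lagrange.nodal Finset.univ ζ).natDegree = N := by simp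
  have hKN : K.coeff N = -c := by
    have h1 := (Lagrange.nodal_monic (s := Finset.univ) (v := ζ)).coeff_natDegree
    rw [hnd] at h1
    rw [hK, coeff_sub, coeff_C_mul, coeff_pfNumer _ _ _ le_rfl, h1]; ring
  have hKm : ∀ m, N < m → K.coeff m = 0 := fun m hm => by
    rw [hK, coeff_sub, coeff_C_mul, coeff_pfNumer _ _ _ hm.le,
      coeff_eq_zero_of_natDegree_lt (by rw [hnd]; exact hm)]; ring
  have hKdeg : K.natDegree = N := by
    refine le_antisymm (natDegree_le_iff_coeff_eq_zero.2 hKm) (le_natDegree_of_ne_zero ?_)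
    rw [hKN]; exact neg_ne_zero.2 hc.ne'
  have hKnode : ∀ j, K.eval (ζ j) = w j * ζ j * ∏ i ∈ Finset.univ.erase j, (ζ j - ζ i) :=
    fun j => by
      rw [hK, eval_sub, eval_pfNumer_node, eval_mul,
        Lagrange.eval_nodal_at_node (Finset.mem_univ j)]; ring
  -- One root lies in each gap. The remaining one lies beyond the last node, where `K` is positive
  -- but tends to `-∞` because its leading coefficient is `-c`.
  have hroots : ∀ j, ∃ y, ζ j < y ∧ (∀ i, j < i → y < ζ i) ∧ K.eval y = 0 := by
    intro j
    by_cases hj : (j : ℕ) + 1 < N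
    · obtain ⟨y, h1, h2, h3⟩ := exists_root_of_mul_neg (K := K)
        (hζ (show j < ⟨j + 1, hj⟩ from Fin.lt_def.2 (by simp))) (by
          rw [hKnode, hKnode]
          have h1 := prod_sub_mul_prod_sub_neg hζ (j := j) (j' := ⟨j + 1, hj⟩) rfl
          have h2 := mul_pos (mul_pos (hw j) (hζ0 j))
            (mul_pos (hw ⟨j + 1, hj⟩) (hζ0 ⟨j + 1, hj⟩))
          calc _ = _ * _ := by ring
            _ < 0 := mul_neg_of_pos_of_neg h2 h1)
      exact ⟨y, h1, fun i hi => h2.trans_le (hζ.monotone (Fin.le_def.2 hi)), h3⟩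
    · have hpos : 0 < K.eval (ζ j) := by
        rw [hKnode]
        refine mul_pos (mul_pos (hw j) (hζ0 j)) (Finset.prod_pos fun i hi => ?_)
        have : i ≠ j := (Finset.mem_erase.1 hi).1
        refine sub_pos.2 (hζ (lt_of_le_of_ne (Fin.le_def.2 ?_) this))
        omega
      have htop : Tendsto (fun x => K.eval x) atTop atBot := by
        refine tendsto_atBot_of_leadingCoeff_nonpos K ?_ ?_
        · rw [← natDegree_pos_iff_degree_pos, hKdeg]; exact j.pos
        · rw [leadingCoeff, hKdeg, hKN]; linarith
      obtain ⟨T, hT1, hT2⟩ := ((htop.eventually_lt_atBot 0).and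
        (eventually_gt_atTop (ζ j))).exists
      obtain ⟨y, h1, h2, h3⟩ := exists_root_of_mul_neg (K := K) hT2
        (mul_neg_of_pos_of_neg hpos hT1)
      exact ⟨y, h1, fun i hi => absurd (Fin.lt_def.1 hi) (by omega), h3⟩
  choose η hη1 hη2 hη3 using hroots
  have hη0 : ∀ j, 0 < η j := fun j => (hζ0 j).trans (hη1 j)
  have hηm : StrictMono η := fun i j hij => (hη2 i j hij).trans (hη1 j)
  have hKη := eq_nodal_of_eval_eq_zero hηm.injective hKm hη3
  rw [hKN] at hKη
  have hsum : 0 ≤ ∑ j, w j := Finset.sum_nonneg fun j _ => (hw j).le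
  have hFη : ∀ j, η j * F.eval (η j) =
      (c + ∑ j, w j) * (Lagrange.nodal Finset.univ ζ).eval (η j) := fun j => by
    have h1 := congrArg (eval (η j)) (X_mul_pfNumer ζ w)
    have h2 := hη3 j
    rw [hK, eval_sub, eval_mul, eval_C] at h2
    rw [eval_mul, eval_X, eval_add, eval_mul, eval_C] at h1
    linear_combination h1 + h2
  refine ⟨η, fun j => Lagrange.nodalWeight Finset.univ η j * F.eval (η j) / c, hη0, hηm, ?_, ?_⟩
  · intro j
    refine div_pos ?_ hc
    refine pos_of_mul_pos_right (a := η j) ?_ (hη0 j).le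
    -- After pairing `η j - η i` with `η j - ζ i`, interlacing gives both factors the same sign.
    have h1 : 0 < Lagrange.nodalWeight Finset.univ η j *
        (Lagrange.nodal Finset.univ ζ).eval (η j) := by
      rw [Lagrange.nodalWeight, Lagrange.eval_nodal,
        ← Finset.mul_prod_erase Finset.univ _ (Finset.mem_univ j), mul_left_comm,
        ← Finset.prod_mul_distrib]
      refine mul_pos (sub_pos.2 (hη1 j)) (Finset.prod_pos fun i hi => ?_)
      rcases lt_or_gt_of_ne (Finset.mem_erase.1 hi).1 with h | h
      · have h2 := hηm h
        have h3 := hη1 i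
        exact mul_pos (inv_pos.2 (by linarith)) (by linarith)
      · have h2 := hηm h
        have h3 := hη2 j i h
        exact mul_pos_of_neg_of_neg (inv_lt_zero.2 (by linarith)) (by linarith)
    calc 0 < (c + ∑ j, w j) * (Lagrange.nodalWeight Finset.univ η j *
        (Lagrange.nodal Finset.univ ζ).eval (η j)) := mul_pos (by linarith) h1
      _ = _ := by linear_combination (-Lagrange.nodalWeight Finset.univ η j) * hFη j
  · intro x hx
    have hz : ∀ j, -x ≠ η j := fun j h => by have := hη0 j; linarith
    have hxζ : ∀ j, x + ζ j ≠ 0 := fun j => by have := hζ0 j; positivity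
    have h1 := eval_div_nodal hηm.injective (F := F)
      (fun m hm => coeff_pfNumer _ _ _ hm.le) hz
    rw [coeff_pfNumer _ _ _ le_rfl, zero_add] at h1
    have h2 : ∑ j, Lagrange.nodalWeight Finset.univ η j * F.eval (η j) / (-x - η j) =
        -c * ∑ j, Lagrange.nodalWeight Finset.univ η j * F.eval (η j) / c / (x + η j) := by
      rw [Finset.mul_sum]
      refine Finset.sum_congr rfl fun j _ => ?_
      have : x + η j ≠ 0 := by have := hη0 j; positivity
      rw [show -x - η j = -(x + η j) by ring]
      field_simp
    have h3 := congrArg (eval (-x)) hKη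
    rw [hK, eval_sub, eval_mul, eval_mul, eval_C, eval_C, eval_pfNumer_neg _ _ hxζ] at h3
    rw [h2, eval_pfNumer_neg _ _ hxζ] at h1
    have hne : (Lagrange.nodal Finset.univ ζ).eval (-x) ≠ 0 := by
      rw [Lagrange.eval_nodal]
      refine Finset.prod_ne_zero_iff.2 fun j _ h => hxζ j (by linarith)
    refine mul_left_cancel₀ hne ?_
    linear_combination (-∑ j, Lagrange.nodalWeight Finset.univ η j * F.eval (η j) / c / (x + η j))
      * h3 + h1

/-- The quotient of two Stieltjes transforms as a shifted Stieltjes transform. -/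
theorem exists_quotient_of_zero {M : ℕ} (ζ w : Fin (M + 1) → ℝ) (hζ0 : ∀ j, 0 < ζ j)
    (hζ : StrictMono ζ) (hw : ∀ j, 0 < w j) :
    ∃ (η β : Fin M → ℝ) (c : ℝ), (∀ j, 0 < η j) ∧ StrictMono η ∧ (∀ j, 0 < β j) ∧ 0 < c ∧
      ∀ x, 0 < x → (c + ∑ j, β j / (x + η j)) * (∑ j, w j * ζ j / (x + ζ j)) =
        ∑ j, w j / (x + ζ j) := by
  set F := pfNumer ζ w with hF
  set K := pfNumer ζ (fun j => w j * ζ j) with hK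
  set L := ∑ j, w j * ζ j with hL
  have hLpos : 0 < L := Finset.sum_pos (fun j _ => mul_pos (hw j) (hζ0 j)) Finset.univ_nonempty
  have hsum : 0 < ∑ j, w j := Finset.sum_pos (fun j _ => hw j) Finset.univ_nonempty
  have hKM : K.coeff M = L := coeff_pfNumer_pred _ _
  have hKm : ∀ m, M < m → K.coeff m = 0 := fun m hm => coeff_pfNumer _ _ _ hm
  have hroots : ∀ j : Fin M, ∃ y, ζ j.castSucc < y ∧ y < ζ j.succ ∧ K.eval y = 0 := by
    intro j
    refine exists_root_of_mul_neg (hζ Fin.castSucc_lt_succ) ?_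
    rw [eval_pfNumer_node, eval_pfNumer_node]
    have h1 := prod_sub_mul_prod_sub_neg hζ (j := j.castSucc) (j' := j.succ) (by simp)
    have h2 := mul_pos (mul_pos (hw j.castSucc) (hζ0 j.castSucc))
      (mul_pos (hw j.succ) (hζ0 j.succ))
    calc _ = _ * _ := by ring
      _ < 0 := mul_neg_of_pos_of_neg h2 h1
  choose η hη1 hη2 hη3 using hroots
  have hη0 : ∀ j, 0 < η j := fun j => (hζ0 _).trans (hη1 j)
  have hsep : ∀ i j : Fin M, i < j → η i < ζ j.castSucc := fun i j hij =>
    (hη2 i).trans_le (hζ.monotone (Fin.le_def.2 (by simpa using hij)))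
  have hηm : StrictMono η := fun i j hij => (hsep i j hij).trans (hη1 j)
  have hKη := eq_nodal_of_eval_eq_zero hηm.injective hKm hη3
  rw [hKM] at hKη
  have hFη : ∀ j, η j * F.eval (η j) =
      (∑ j, w j) * (Lagrange.nodal Finset.univ ζ).eval (η j) := fun j => by
    have h1 := congrArg (eval (η j)) (X_mul_pfNumer ζ w)
    rw [eval_mul, eval_X, eval_add, eval_mul, eval_C, ← hK, hη3 j, zero_add] at h1
    exact h1
  refine ⟨η, fun j => -(Lagrange.nodalWeight Finset.univ η j * F.eval (η j)) / L,
    (∑ j, w j) / L, hη0, hηm, ?_, div_pos hsum hLpos, ?_⟩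
  · intro j
    refine div_pos ?_ hLpos
    refine pos_of_mul_pos_right (a := η j) ?_ (hη0 j).le
    -- There is one node more than there are roots: the unpaired factor `η j - ζ (Fin.last M)` is
    -- negative and reverses the sign.
    have h1 : Lagrange.nodalWeight Finset.univ η j *
        (Lagrange.nodal Finset.univ ζ).eval (η j) < 0 := by
      rw [Lagrange.nodalWeight, Lagrange.eval_nodal, Fin.prod_univ_castSucc,
        ← Finset.mul_prod_erase Finset.univ _ (Finset.mem_univ j), ← mul_assoc, mul_left_comm,
        ← Finset.prod_mul_distrib]
      have hlast : η j - ζ (Fin.last M) < 0 :=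
        sub_neg.2 ((hη2 j).trans_le (hζ.monotone (Fin.le_last _)))
      refine mul_neg_of_pos_of_neg
        (mul_pos (sub_pos.2 (hη1 j)) (Finset.prod_pos fun i hi => ?_)) hlast
      rcases lt_or_gt_of_ne (Finset.mem_erase.1 hi).1 with h | h
      · have h2 := hηm h
        have h3 := hη1 i
        exact mul_pos (inv_pos.2 (by linarith)) (by linarith)
      · have h2 := hηm h
        have h3 := hsep j i h
        exact mul_pos_of_neg_of_neg (inv_lt_zero.2 (by linarith)) (by linarith)
    calc 0 < -((∑ j, w j) * (Lagrange.nodalWeight Finset.univ η j *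
        (Lagrange.nodal Finset.univ ζ).eval (η j))) := neg_pos.2 (mul_neg_of_pos_of_neg hsum h1)
      _ = _ := by linear_combination (Lagrange.nodalWeight Finset.univ η j) * hFη j
  · intro x hx
    have hz : ∀ j, -x ≠ η j := fun j h => by have := hη0 j; linarith
    have hxζ : ∀ j, x + ζ j ≠ 0 := fun j => by have := hζ0 j; positivity
    have h1 := eval_div_nodal hηm.injective (F := F) (fun m hm => coeff_pfNumer _ _ _ hm) hz
    rw [coeff_pfNumer_pred] at h1
    have h2 : ∑ j, w j + ∑ j, Lagrange.nodalWeight Finset.univ η j * F.eval (η j) / (-x - η j) =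
        L * ((∑ j, w j) / L +
          ∑ j, -(Lagrange.nodalWeight Finset.univ η j * F.eval (η j)) / L / (x + η j)) := by
      rw [mul_add, mul_div_cancel₀ _ hLpos.ne', Finset.mul_sum]
      congr 1
      refine Finset.sum_congr rfl fun j _ => ?_
      have : x + η j ≠ 0 := by have := hη0 j; positivity
      rw [show -x - η j = -(x + η j) by ring]
      field_simp
    have h3 := congrArg (eval (-x)) hKη
    rw [eval_mul, eval_C, eval_pfNumer_neg _ _ hxζ] at h3
    rw [h2, eval_pfNumer_neg _ _ hxζ] at h1
    have hne : (Lagrange.nodal Finset.univ ζ).eval (-x) ≠ 0 := by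
      rw [Lagrange.eval_nodal]
      refine Finset.prod_ne_zero_iff.2 fun j _ h => hxζ j (by linarith)
    refine mul_left_cancel₀ hne ?_
    linear_combination (-((∑ j, w j) / L +
      ∑ j, -(Lagrange.nodalWeight Finset.univ η j * F.eval (η j)) / L / (x + η j))) * h3 + h1

/-! ### Existence -/

/-- Spectral data for `n` masses. -/
structure Admissible (n : ℕ) {N : ℕ} (ζ b : Fin N → ℝ) (c : ℝ) : Prop where
  card : N = n / 2
  pos : ∀ j, 0 < ζ j
  mono : StrictMono ζ
  weight_pos : ∀ j, 0 < b j
  odd : Odd n → 0 < c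
  even : Even n → c = 0

theorem Admissible.nonneg {n N : ℕ} {ζ b : Fin N → ℝ} {c : ℝ} (h : Admissible n ζ b c) :
    0 ≤ c := by
  rcases Nat.even_or_odd n with hn | hn
  · exact (h.even hn).ge
  · exact (h.odd hn).le

theorem Admissible.transform_pos {n N : ℕ} {ζ b : Fin N → ℝ} {c : ℝ}
    (h : Admissible (n + 1) ζ b c) {x : ℝ} (hx : 0 < x) : 0 < c + ∑ j, b j / (x + ζ j) := by
  have hpos : ∀ j, 0 < b j / (x + ζ j) := fun j =>
    div_pos (h.weight_pos j) (add_pos hx (h.pos j))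
  rcases Nat.even_or_odd (n + 1) with hn | hn
  · have : 0 < N := by
      obtain ⟨r, hr⟩ := hn
      have := h.card
      omega
    have : Nonempty (Fin N) := ⟨⟨0, this⟩⟩
    have h1 : 0 < ∑ j, b j / (x + ζ j) :=
      Finset.sum_pos (fun j _ => hpos j) Finset.univ_nonempty
    linarith [h.nonneg]
  · have h1 : 0 ≤ ∑ j, b j / (x + ζ j) := Finset.sum_nonneg fun j _ => (hpos j).le
    linarith [h.odd hn]

/-- Removing one site from admissible spectral data gives admissible spectral data. -/
theorem Admissible.exists_step {n N : ℕ} {ζ b : Fin N → ℝ} {c : ℝ}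
    (h : Admissible (n + 1) ζ b c) {e : ℝ} (he : 0 < e) :
    ∃ (N' : ℕ) (ζ' b' : Fin N' → ℝ) (c' : ℝ), Admissible n ζ' b' c' ∧ ∀ x, 0 < x →
      (c' + ∑ j, b' j / (x + ζ' j)) * (1 - x * (c + ∑ j, b j / (x + ζ j)) /
        (e * (c + ∑ j, b j / (e + ζ j)))) =
      (c + ∑ j, b j / (x + ζ j)) - (c + ∑ j, b j / (e + ζ j)) := by
  have hh := h.transform_pos he
  set η := c + ∑ j, b j / (e + ζ j) with hη
  set w : Fin N → ℝ := fun j => b j / (e + ζ j) with hw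
  have hwpos : ∀ j, 0 < w j := fun j => div_pos (h.weight_pos j) (add_pos he (h.pos j))
  have hnum : ∀ x, 0 < x → (c + ∑ j, b j / (x + ζ j)) - η =
      (e - x) * ∑ j, w j / (x + ζ j) := fun x hx => by
    rw [hη, add_sub_add_left_eq_sub, ← Finset.sum_sub_distrib, Finset.mul_sum]
    refine Finset.sum_congr rfl fun j _ => ?_
    have h1 : x + ζ j ≠ 0 := (add_pos hx (h.pos j)).ne'
    have h2 : e + ζ j ≠ 0 := (add_pos he (h.pos j)).ne'
    simp only [hw]
    field_simp
    ring
  have hden : ∀ x, 0 < x → 1 - x * (c + ∑ j, b j / (x + ζ j)) / (e * η) =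
      (e - x) * (c + ∑ j, w j * ζ j / (x + ζ j)) / (e * η) := fun x hx => by
    rw [eq_div_iff (mul_pos he hh).ne', sub_mul, div_mul_cancel₀ _ (mul_pos he hh).ne', one_mul]
    have h3 : e * ∑ j, b j / (e + ζ j) - x * ∑ j, b j / (x + ζ j) =
        (e - x) * ∑ j, w j * ζ j / (x + ζ j) := by
      rw [Finset.mul_sum, Finset.mul_sum, Finset.mul_sum, ← Finset.sum_sub_distrib]
      refine Finset.sum_congr rfl fun j _ => ?_
      have h1 : x + ζ j ≠ 0 := (add_pos hx (h.pos j)).ne'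
      have h2 : e + ζ j ≠ 0 := (add_pos he (h.pos j)).ne'
      simp only [hw]
      field_simp
      ring
    rw [hη]
    linear_combination h3
  -- The factor `e - x` is common to numerator and denominator and drops out; the scalar `e * η` is
  -- absorbed into the new weights and constant.
  suffices H : ∃ (N' : ℕ) (ζ' b' : Fin N' → ℝ) (c' : ℝ), Admissible n ζ' b' c' ∧ ∀ x, 0 < x →
      (c' + ∑ j, b' j / (x + ζ' j)) * (c + ∑ j, w j * ζ j / (x + ζ j)) =
        ∑ j, w j / (x + ζ j) by
    obtain ⟨N', ζ', b', c', hadm, hx⟩ := H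
    refine ⟨N', ζ', fun j => e * η * b' j, e * η * c', ⟨hadm.card, hadm.pos, hadm.mono,
      fun j => mul_pos (mul_pos he hh) (hadm.weight_pos j),
      fun hn => mul_pos (mul_pos he hh) (hadm.odd hn), fun hn => by rw [hadm.even hn, mul_zero]⟩,
      fun x hx0 => ?_⟩
    rw [hnum x hx0, hden x hx0, ← hx x hx0]
    simp only [mul_div_assoc (e * η), ← Finset.mul_sum]
    have hne := (mul_pos he hh).ne'
    field_simp
  -- For even `n` the old constant is positive: the number of poles persists and the new constant is
  -- zero. For odd `n` the old constant is zero: one pole is lost and a positive constant appears.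
  rcases Nat.even_or_odd n with hn | hn
  · obtain ⟨ζ', b', h1, h2, h3, h4⟩ :=
      exists_quotient_of_pos ζ w h.pos h.mono hwpos (h.odd hn.add_one)
    refine ⟨N, ζ', b', 0, ⟨?_, h1, h2, h3, fun ho => absurd hn (Nat.not_even_iff_odd.2 ho),
      fun _ => rfl⟩, fun x hx => by rw [zero_add, h4 x hx]⟩
    obtain ⟨r, hr⟩ := hn
    have := h.card
    omega
  · obtain ⟨r, hr⟩ := hn
    have hN : N = r + 1 := by have := h.card; omega
    subst hN
    obtain ⟨ζ', b', c', h1, h2, h3, h4, h5⟩ := exists_quotient_of_zero ζ w h.pos h.mono hwpos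
    have hc0 := h.even (Odd.add_one ⟨r, hr⟩)
    refine ⟨r, ζ', b', c', ⟨by omega, h1, h2, h3, fun _ => h4, fun hev =>
      absurd hev (Nat.not_even_iff_odd.2 ⟨r, hr⟩)⟩, fun x hx => by rw [hc0, zero_add, h5 x hx]⟩

theorem chain_congr {g h g' h' : ℕ → ℝ} {n : ℕ} (hg : ∀ k < n, g k = g' k)
    (hh : ∀ k < n, h k = h' k) : chain g h n = chain g' h' n := by
  induction n with
  | zero => rfl
  | succ n ih =>
    have := ih (fun k hk => hg k (by omega)) fun k hk => hh k (by omega)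
    simp only [chain, this, hg n (by omega), hh n (by omega)]

/-- The step is run backwards: solve the reduced data with one site fewer, then append a site with
`h` the value of the transform at `1 / r n`, and `g = r n / h`. -/
theorem Admissible.exists_solution {n : ℕ} {r : ℕ → ℝ} (hr : ∀ k, 0 < r k) :
    ∀ {N : ℕ} {ζ b : Fin N → ℝ} {c : ℝ}, Admissible n ζ b c →
    ∃ g h : ℕ → ℝ, (∀ k, 0 < g k) ∧ (∀ k, 0 < h k) ∧ (∀ k, g k * h k = r k) ∧
      ∀ x, 0 < x → (c + ∑ j, b j / (x + ζ j)) * (chain g h n).2.eval x =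
        (chain g h n).1.eval x := by
  induction n with
  | zero =>
    intro N ζ b c hadm
    obtain rfl : N = 0 := by simpa using hadm.card
    refine ⟨r, fun _ => 1, hr, fun _ => one_pos, by simp, fun x hx => ?_⟩
    simp [chain, hadm.even]
  | succ n ih =>
    intro N ζ b c hadm
    have he : 0 < 1 / r n := one_div_pos.2 (hr n)
    obtain ⟨N', ζ', b', c', hadm', hx⟩ := hadm.exists_step he
    have hη := hadm.transform_pos he
    set η := c + ∑ j, b j / (1 / r n + ζ j)
    obtain ⟨g, h, hg, hh, hgh, hW⟩ := ih hadm'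
    refine ⟨Function.update g n (r n / η), Function.update h n η, fun k => ?_, fun k => ?_,
      fun k => ?_, fun x hx0 => ?_⟩
    · rcases eq_or_ne k n with rfl | hk
      · simpa using div_pos (hr k) hη
      · simpa [hk] using hg k
    · rcases eq_or_ne k n with rfl | hk
      · simpa using hη
      · simpa [hk] using hh k
    · rcases eq_or_ne k n with rfl | hk
      · simp [hη.ne']
      · simpa [hk] using hgh k
    · have hcongr : chain (Function.update g n (r n / η)) (Function.update h n η) n =
          chain g h n :=
        chain_congr (fun k hk => Function.update_of_ne hk.ne _ _)
          fun k hk => Function.update_of_ne hk.ne _ _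
      have h1 := hx x hx0
      have h2 := hW x hx0
      simp only [chain, hcongr, Function.update_self, eval_add, eval_mul, eval_C, eval_X]
      rw [← h2]
      have h3 : x * (c + ∑ j, b j / (x + ζ j)) / (1 / r n * η) =
          x * (c + ∑ j, b j / (x + ζ j)) * (r n / η) := by
        have := (hr n).ne'
        field_simp
      rw [h3] at h1
      linear_combination (-(chain g h n).2.eval x) * h1

/-! ### The solution of the inverse problem -/

/-- Extension of a finite sequence by ones. -/
def extendOne {n : ℕ} (f : Fin n → ℝ) (k : ℕ) : ℝ := if h : k < n then f ⟨k, h⟩ else 1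

theorem extendOne_coe {n : ℕ} (f : Fin n → ℝ) (j : Fin n) : extendOne f j = f j := by
  simp [extendOne]

theorem extendOne_pos {n : ℕ} {f : Fin n → ℝ} (hf : ∀ j, 0 < f j) (k : ℕ) :
    0 < extendOne f k := by
  unfold extendOne
  split_ifs
  · exact hf _
  · exact one_pos

/-- The numbers `1 / m²`, listed from the right. -/
def revNodes {n : ℕ} (m : Fin n → ℝ) (k : ℕ) : ℝ := 1 / extendOne m (n - 1 - k) ^ 2

theorem revNodes_pos {n : ℕ} {m : Fin n → ℝ} (hm : ∀ j, 0 < m j) (k : ℕ) : 0 < revNodes m k :=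
  one_div_pos.2 (pow_pos (extendOne_pos hm _) 2)

theorem revNodes_coe {n : ℕ} (m : Fin n → ℝ) (i : Fin n) : revNodes m i = 1 / m i.rev ^ 2 := by
  rw [revNodes, ← extendOne_coe m i.rev, Fin.val_rev]
  congr 3
  omega

theorem revNodes_injOn {n : ℕ} {m : Fin n → ℝ} (hm : ∀ j, 0 < m j) (hinj : Function.Injective m)
    (i j : ℕ) (hi : i < n) (hj : j < n) (h : revNodes m i = revNodes m j) : i = j := by
  have h1 := revNodes_coe m ⟨i, hi⟩
  have h2 := revNodes_coe m ⟨j, hj⟩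
  simp only at h1 h2
  rw [h1, h2, one_div, one_div, inv_inj] at h
  have h3 := hinj ((pow_left_inj₀ (hm _).le (hm _).le two_ne_zero).1 h)
  simpa using h3

/-- The solution `h` of the inverse problem. -/
def solH {n N : ℕ} (ζ b : Fin N → ℝ) (c : ℝ) (m : Fin n → ℝ) (j : Fin n) : ℝ :=
  peelWeight ζ b c (revNodes m) (n - 1 - j)

/-- The solution `g` of the inverse problem. -/
def solG {n N : ℕ} (ζ b : Fin N → ℝ) (c : ℝ) (m : Fin n → ℝ) (j : Fin n) : ℝ :=
  m j ^ 2 / solH ζ b c m j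

/-- The positions associated with the solution of the inverse problem. -/
def solX {n N : ℕ} (ζ b : Fin N → ℝ) (c : ℝ) (m : Fin n → ℝ) (j : Fin n) : ℝ :=
  Real.log (solH ζ b c m j / m j)

section Solution

variable {n N : ℕ} {ζ b : Fin N → ℝ} {c : ℝ} {m : Fin n → ℝ}

theorem IsInverseSolution.sequence_facts (hζ : ∀ j, 0 < ζ j) (hb : ∀ j, 0 < b j)
    (hm : ∀ j, 0 < m j) {g h : Fin n → ℝ}
    (hs : IsInverseSolution m (discreteMeasure ζ b) c g h) :
    (∀ k < n, extendOne g (n - 1 - k) * extendOne h (n - 1 - k) * revNodes m k = 1) ∧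
    ∀ x, 0 < x → stieltjes (discreteMeasure ζ b) c x *
      (chain (extendOne g) (extendOne h) n).2.eval x =
      (chain (extendOne g) (extendOne h) n).1.eval x := by
  constructor
  · intro k hk
    have hlt : n - 1 - k < n := by omega
    have h1 := hs.g_mul_h ⟨n - 1 - k, hlt⟩
    have h2 := extendOne_pos hm (n - 1 - k)
    have h3 : extendOne m (n - 1 - k) = m ⟨n - 1 - k, hlt⟩ := extendOne_coe m ⟨n - 1 - k, hlt⟩
    rw [revNodes, extendOne_coe g ⟨n - 1 - k, hlt⟩, extendOne_coe h ⟨n - 1 - k, hlt⟩, h1, ← h3]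
    field_simp
  · exact (weyl_eq_iff ζ b hζ hb c g h _ _ (extendOne_coe g) (extendOne_coe h)
      (extendOne_pos hs.g_pos) (extendOne_pos hs.h_pos)).1 hs.weyl_eq

theorem IsInverseSolution.peel_facts (hζ : ∀ j, 0 < ζ j) (hb : ∀ j, 0 < b j)
    (hm : ∀ j, 0 < m j) {g h : Fin n → ℝ}
    (hs : IsInverseSolution m (discreteMeasure ζ b) c g h) (k : ℕ) (hk : k < n) :
    extendOne h (n - 1 - k) = peelWeight ζ b c (revNodes m) k ∧
      0 < pfEval ζ (peel ζ b c (revNodes m) k).1 (revNodes m k) ∧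
      0 < pfEval ζ (peel ζ b c (revNodes m) k).2 (revNodes m k) := by
  obtain ⟨h1, h2⟩ := hs.sequence_facts hζ hb hm
  simp only [stieltjes_discreteMeasure ζ b hb] at h2
  exact (chain_eq_peel hζ (revNodes_pos hm) (extendOne_pos hs.g_pos) (extendOne_pos hs.h_pos)
    h1 h2 k hk.le).2 hk

theorem IsInverseSolution.eq_sol (hζ : ∀ j, 0 < ζ j) (hb : ∀ j, 0 < b j)
    (hm : ∀ j, 0 < m j) {g h : Fin n → ℝ}
    (hs : IsInverseSolution m (discreteMeasure ζ b) c g h) :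
    g = solG ζ b c m ∧ h = solH ζ b c m := by
  have hh : h = solH ζ b c m := by
    funext j
    have h1 := (hs.peel_facts hζ hb hm (n - 1 - j) (by omega)).1
    rw [show n - 1 - (n - 1 - (j : ℕ)) = j by omega, extendOne_coe] at h1
    exact h1
  refine ⟨funext fun j => ?_, hh⟩
  rw [solG, ← hh, eq_div_iff (hs.h_pos j).ne', hs.g_mul_h]

/-- Positivity and the Weyl identity are not checked on the recursion itself: some solution exists
by induction, and uniqueness identifies it with the recursive one. -/
theorem Admissible.isInverseSolution (hadm : Admissible n ζ b c) (hm : ∀ j, 0 < m j) :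
    IsInverseSolution m (discreteMeasure ζ b) c (solG ζ b c m) (solH ζ b c m) := by
  obtain ⟨g, h, hg, hh, hgh, hW⟩ :=
    hadm.exists_solution (r := fun k => extendOne m k ^ 2)
      fun k => pow_pos (extendOne_pos hm k) 2
  have hs : IsInverseSolution m (discreteMeasure ζ b) c (fun j => g j) (fun j => h j) := by
    refine ⟨fun j => hg j, fun j => hh j, fun j => by rw [hgh, extendOne_coe], ?_⟩
    refine (weyl_eq_iff ζ b hadm.pos hadm.weight_pos c _ _ g h (fun _ => rfl) (fun _ => rfl)
      hg hh).2 ?_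
    simpa only [stieltjes_discreteMeasure ζ b hadm.weight_pos] using hW
  obtain ⟨h1, h2⟩ := hs.eq_sol hadm.pos hadm.weight_pos hm
  rwa [h1, h2] at hs

theorem Admissible.isTheSolution (hadm : Admissible n ζ b c) (hm : ∀ j, 0 < m j) :
    IsTheSolution m (discreteMeasure ζ b) c (solG ζ b c m) (solH ζ b c m) (solX ζ b c m) := by
  have hsol := hadm.isInverseSolution hm
  have hiff : ∀ g' h' : Fin n → ℝ, IsInverseSolution m (discreteMeasure ζ b) c g' h' ↔
      g' = solG ζ b c m ∧ h' = solH ζ b c m := fun g' h' =>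
    ⟨fun hs => hs.eq_sol hadm.pos hadm.weight_pos hm, fun ⟨h1, h2⟩ => by rw [h1, h2]; exact hsol⟩
  refine ⟨hiff, fun j => rfl, fun y hy => ?_⟩
  rw [hasSpectralData_iff m y hm hy]
  have hprod : ∀ j, m j * Real.exp (-y j) * (m j * Real.exp (y j)) = m j ^ 2 := fun j => by
    have : Real.exp (-y j) * Real.exp (y j) = 1 := by rw [← Real.exp_add]; simp
    linear_combination m j ^ 2 * this
  constructor
  · intro hw
    have h1 := ((hiff _ _).1 ⟨fun j => mul_pos (hm j) (Real.exp_pos _),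
      fun j => mul_pos (hm j) (Real.exp_pos _), hprod, hw⟩).2
    funext j
    rw [solX, ← h1, mul_div_cancel_left₀ _ (hm j).ne', Real.log_exp]
  · intro hyx
    have h2 : (fun j => m j * Real.exp (y j)) = solH ζ b c m := by
      funext j
      rw [hyx, solX, Real.exp_log (div_pos (hsol.h_pos j) (hm j)), mul_div_cancel₀ _ (hm j).ne']
    have h1 : (fun j => m j * Real.exp (-y j)) = solG ζ b c m := by
      funext j
      rw [solG, ← h2, eq_div_iff (mul_pos (hm j) (Real.exp_pos _)).ne', hprod]
    rw [h1, h2]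
    exact hsol.weyl_eq

/-! ### Continuity in the masses -/

theorem continuousOn_revNodes (k : ℕ) :
    ContinuousOn (fun m : Fin n → ℝ => revNodes m k) {m | ∀ j, 0 < m j} := by
  have h1 : Continuous fun m : Fin n → ℝ => extendOne m (n - 1 - k) := by
    unfold extendOne
    split_ifs
    · exact continuous_apply _
    · exact continuous_const
  exact continuousOn_const.div (h1.pow 2).continuousOn fun m hm =>
    (pow_pos (extendOne_pos hm _) 2).ne'

theorem continuousOn_pfEval_comp {T : Type*} [TopologicalSpace T] {S : Set T}
    {v : T → ℝ × (Fin N → ℝ)} {x : T → ℝ} (hζ : ∀ j, 0 < ζ j) (hv : ContinuousOn v S)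
    (hx : ContinuousOn x S) (hx0 : ∀ t ∈ S, 0 < x t) :
    ContinuousOn (fun t => pfEval ζ (v t) (x t)) S := by
  refine (continuous_fst.comp_continuousOn hv).add (continuousOn_finsetSum _ fun j _ => ?_)
  exact ((continuous_apply j).comp_continuousOn (continuous_snd.comp_continuousOn hv)).div
    (hx.add continuousOn_const) fun t ht => (add_pos (hx0 t ht) (hζ j)).ne'

/-- The recursion is rational in the nodes, and its denominators are positive because a solution
exists for all positive masses, even coinciding ones. -/
theorem Admissible.continuousOn_peel (hadm : Admissible n ζ b c) (k : ℕ) (hk : k ≤ n) :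
    ContinuousOn (fun m : Fin n → ℝ => peel ζ b c (revNodes m) k) {m | ∀ j, 0 < m j} ∧
    (k < n → ContinuousOn (fun m : Fin n → ℝ => peelWeight ζ b c (revNodes m) k)
      {m | ∀ j, 0 < m j}) := by
  have hfacts : ∀ m : Fin n → ℝ, (∀ j, 0 < m j) → ∀ k < n, _ := fun m hm k hk =>
    (hadm.isInverseSolution hm).peel_facts hadm.pos hadm.weight_pos hm k hk
  have hweight : ∀ k < n,
      ContinuousOn (fun m : Fin n → ℝ => peel ζ b c (revNodes m) k) {m | ∀ j, 0 < m j} →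
      ContinuousOn (fun m : Fin n → ℝ => peelWeight ζ b c (revNodes m) k)
        {m | ∀ j, 0 < m j} := fun k hk hc => by
    have he := continuousOn_revNodes (n := n) k
    have he0 : ∀ m ∈ {m : Fin n → ℝ | ∀ j, 0 < m j}, 0 < revNodes m k := fun m hm =>
      revNodes_pos hm k
    exact (continuousOn_pfEval_comp hadm.pos (continuous_fst.comp_continuousOn hc) he he0).div
      (continuousOn_pfEval_comp hadm.pos (continuous_snd.comp_continuousOn hc) he he0)
      fun m hm => (hfacts m hm k hk).2.2.ne'
  have hpeel : ContinuousOn (fun m : Fin n → ℝ => peel ζ b c (revNodes m) k)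
      {m | ∀ j, 0 < m j} := by
    induction k with
    | zero => exact continuousOn_const
    | succ k ih =>
      have hc := ih (by omega)
      have hw := hweight k hk hc
      have he := continuousOn_revNodes (n := n) k
      have h1 := continuous_fst.comp_continuousOn hc
      have h2 := continuous_snd.comp_continuousOn hc
      have h10 := continuous_fst.comp_continuousOn h1
      have h11 := fun j => (continuous_apply j).comp_continuousOn
        (continuous_snd.comp_continuousOn h1)
      have h21 := fun j => (continuous_apply j).comp_continuousOn
        (continuous_snd.comp_continuousOn h2)
      have hne : ∀ m ∈ {m : Fin n → ℝ | ∀ j, 0 < m j}, ∀ j, revNodes m k + ζ j ≠ 0 :=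
        fun m hm j => (add_pos (revNodes_pos hm k) (hadm.pos j)).ne'
      have hne' : ∀ m ∈ {m : Fin n → ℝ | ∀ j, 0 < m j},
          revNodes m k * peelWeight ζ b c (revNodes m) k ≠ 0 := fun m hm => by
        obtain ⟨_, h3, h4⟩ := hfacts m hm k hk
        exact (mul_pos (revNodes_pos hm k) (div_pos h3 h4)).ne'
      refine ContinuousOn.prodMk (ContinuousOn.prodMk continuousOn_const
        (continuousOn_pi.2 fun j => ?_)) (ContinuousOn.prodMk ?_ (continuousOn_pi.2 fun j => ?_))
      · exact ((h11 j).sub (hw.mul (h21 j))).div (he.add continuousOn_const)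
          fun m hm => hne m hm j
      · exact h10.div (he.mul hw) hne'
      · exact ((h21 j).add (((h11 j).mul continuousOn_const).div (he.mul hw) hne')).div
          (he.add continuousOn_const) fun m hm => hne m hm j
  exact ⟨hpeel, fun hkn => hweight k hkn hpeel⟩

theorem Admissible.continuousOn_solH (hadm : Admissible n ζ b c) :
    ContinuousOn (fun m : Fin n → ℝ => solH ζ b c m) {m | ∀ j, 0 < m j} :=
  continuousOn_pi.2 fun j =>
    (hadm.continuousOn_peel (n - 1 - j) (by omega)).2 (by omega)

theorem Admissible.continuousOn_solG (hadm : Admissible n ζ b c) :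
    ContinuousOn (fun m : Fin n → ℝ => solG ζ b c m) {m | ∀ j, 0 < m j} :=
  continuousOn_pi.2 fun j => (((continuous_apply j).pow 2).continuousOn).div
    (continuousOn_pi.1 hadm.continuousOn_solH j)
    fun _ hm => ((hadm.isInverseSolution hm).h_pos j).ne'

theorem Admissible.continuousOn_solX (hadm : Admissible n ζ b c) :
    ContinuousOn (fun m : Fin n → ℝ => solX ζ b c m) {m | ∀ j, 0 < m j} :=
  continuousOn_pi.2 fun j => ((continuousOn_pi.1 hadm.continuousOn_solH j).div
    (continuous_apply j).continuousOn fun _ hm => (hm j).ne').log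
    fun _ hm => (div_pos ((hadm.isInverseSolution hm).h_pos j) (hm j)).ne'

/-! ### The explicit formulas -/

/-- The absolute value of the determinant of the Cauchy-Stieltjes-Vandermonde matrix whose nodes
are the first `k` terms of a sequence. -/
def seqDet (e : ℕ → ℝ) (ν : Measure ℝ) (c : ℝ) (k l p : ℕ) : ℝ :=
  |(csv k l p (fun i : Fin k => e i) ν c).det|

theorem nodes_eq (m : Fin n → ℝ) (k : Fin (n + 1)) :
    nodes m k = fun i : Fin k => revNodes m i := by
  funext i
  have := revNodes_coe m (Fin.castLE k.is_le i)
  rw [Fin.val_castLE] at this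
  rw [this, nodes]

theorem absDet_eq (m : Fin n → ℝ) (ν : Measure ℝ) (c : ℝ) (k : Fin (n + 1)) (l p : ℕ) :
    absDet m ν c k l p = seqDet (revNodes m) ν c k l p := by
  rw [absDet, seqDet, nodes_eq]

theorem nodeProd_eq (m : Fin n → ℝ) (k : Fin (n + 1)) :
    nodeProd m k = ∏ i ∈ Finset.range k, revNodes m i := by
  rw [nodeProd, nodes_eq, Fin.prod_univ_eq_prod_range (fun i => revNodes m i)]

theorem Admissible.formulas (hadm : Admissible n ζ b c) (hm : ∀ j, 0 < m j)
    (hinj : Function.Injective m) (i : Fin n) :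
    solG ζ b c m i.rev = gFormula m (discreteMeasure ζ b) c i ∧
    solH ζ b c m i.rev = hFormula m (discreteMeasure ζ b) c i ∧
    solX ζ b c m i.rev = xFormula m (discreteMeasure ζ b) c i := by
  have hs := hadm.isInverseSolution hm
  obtain ⟨h1, h2⟩ := hs.sequence_facts hadm.pos hadm.weight_pos hm
  set e := revNodes m with he
  set ν := discreteMeasure ζ b with hν
  have hpos : ∀ k ≤ n, 0 < seqDet e ν c k ((k + 1) / 2) 0 ∧ 0 < seqDet e ν c k (k / 2) 1 :=
    abs_det_csv_pos (extendOne_pos hs.g_pos) (extendOne_pos hs.h_pos) (revNodes_pos hm) h1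
      (revNodes_injOn hm hinj) h2
  have hw : extendOne (solH ζ b c m) (n - 1 - i) = (∏ k ∈ Finset.range (i : ℕ), e k) *
      seqDet e ν c (i + 1) ((i + 2) / 2) 0 * seqDet e ν c i ((i + 1) / 2) 0 /
      (seqDet e ν c (i + 1) ((i + 1) / 2) 1 * seqDet e ν c i (i / 2) 1) :=
    weight_eq_det (extendOne_pos hs.g_pos) (extendOne_pos hs.h_pos) (revNodes_pos hm) h1
      (revNodes_injOn hm hinj) h2 i i.2
  have hrev : n - 1 - (i : ℕ) = (i.rev : ℕ) := by rw [Fin.val_rev]; omega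
  rw [hrev, extendOne_coe] at hw
  obtain ⟨pA, pB⟩ := hpos i i.2.le
  obtain ⟨pA', pB'⟩ := hpos (i + 1) i.2
  have hE : 0 < ∏ k ∈ Finset.range (i : ℕ), e k :=
    Finset.prod_pos fun k _ => revNodes_pos hm k
  have hmi := hm i.rev
  have hnode : e i = 1 / m i.rev ^ 2 := revNodes_coe m i
  unfold gFormula hFormula xFormula
  simp only [absDet_eq, nodeProd_eq, Fin.val_succ, Fin.val_castSucc, Finset.prod_range_succ,
    solX, solG, hw, ← he, hnode]
  generalize (∏ k ∈ Finset.range (i : ℕ), e k) = E at *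
  -- With `k = i + 1`, even `i` is the odd case of the stated formulas; the floor halves of
  -- `weight_eq_det` become the indices given there.
  rcases Nat.even_or_odd (i : ℕ) with hi | hi
  · obtain ⟨r, hr⟩ := hi
    have hodd : Odd ((i : ℕ) + 1) := Even.add_one ⟨r, hr⟩
    simp only [hodd, if_true, show ((i : ℕ) + 1 - 1) / 2 = r by omega,
      show ((i : ℕ) + 1 + 1) / 2 = r + 1 by omega,
      show ((i : ℕ) + 1) / 2 = r by omega, show (i : ℕ) / 2 = r by omega] at *
    refine ⟨?_, ?_, ?_⟩
    · field_simp
    · trivial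
    · congr 1
      field_simp
  · obtain ⟨r, hr⟩ := hi
    have hodd : ¬ Odd ((i : ℕ) + 1) := Nat.not_odd_iff_even.2 (Odd.add_one ⟨r, hr⟩)
    simp only [hodd, if_false, Nat.add_sub_cancel,
      show ((i : ℕ) + 1 + 1) / 2 = r + 1 by omega,
      show ((i : ℕ) + 1) / 2 = r + 1 by omega, show (i : ℕ) / 2 = r by omega] at *
    refine ⟨?_, ?_, ?_⟩
    · field_simp
    · trivial
    · congr 1
      field_simp

end Solution

end MCH

end

theorem theorem4p9 (n : ℕ) (ζ b : Fin (n / 2) → ℝ) (c : ℝ)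
    (hζ_pos : ∀ j, 0 < ζ j) (hζ_mono : StrictMono ζ) (hb_pos : ∀ j, 0 < b j)
    (hc_odd : Odd n → 0 < c) (hc_even : Even n → c = 0) :
    (∀ m : Fin n → ℝ, (∀ j, 0 < m j) → Function.Injective m →
      MCH.IsTheSolution m (MCH.discreteMeasure ζ b) c
        (fun j => MCH.gFormula m (MCH.discreteMeasure ζ b) c j.rev)
        (fun j => MCH.hFormula m (MCH.discreteMeasure ζ b) c j.rev)
        (fun j => MCH.xFormula m (MCH.discreteMeasure ζ b) c j.rev)) ∧
    ∃ G H X : (Fin n → ℝ) → Fin n → ℝ,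
      ContinuousOn G {m | ∀ j, 0 < m j} ∧
      ContinuousOn H {m | ∀ j, 0 < m j} ∧
      ContinuousOn X {m | ∀ j, 0 < m j} ∧
      (∀ m : Fin n → ℝ, (∀ j, 0 < m j) → Function.Injective m → ∀ i : Fin n,
        G m i.rev = MCH.gFormula m (MCH.discreteMeasure ζ b) c i ∧
        H m i.rev = MCH.hFormula m (MCH.discreteMeasure ζ b) c i ∧
        X m i.rev = MCH.xFormula m (MCH.discreteMeasure ζ b) c i) ∧
      ∀ m : Fin n → ℝ, (∀ j, 0 < m j) →
        MCH.IsTheSolution m (MCH.discreteMeasure ζ b) c (G m) (H m) (X m) := by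
  have hadm : MCH.Admissible n ζ b c := ⟨rfl, hζ_pos, hζ_mono, hb_pos, hc_odd, hc_even⟩
  refine ⟨fun m hm hinj => ?_, MCH.solG ζ b c, MCH.solH ζ b c, MCH.solX ζ b c,
    hadm.continuousOn_solG, hadm.continuousOn_solH, hadm.continuousOn_solX,
    fun m hm hinj i => hadm.formulas hm hinj i, fun m hm => hadm.isTheSolution hm⟩
  have hf := fun j : Fin n => hadm.formulas hm hinj j.rev
  simp only [Fin.rev_rev] at hf
  simp only [← (hf _).1, ← (hf _).2.1, ← (hf _).2.2]
  exact hadm.isTheSolution hm
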